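/- Let $\Omega\subset\mathbb{R}^n$ be a bounded open set and let $X_1,\dots,X_m$ be smooth vector fields on $\Omega$ (for instance the restrictions of a basis of the first layer of the left-invariant vector fields of a Carnot group $(\mathbb{R}^n,*)$). For a function $w$ write $\mathfrak{X}w=(X_1w,\dots,X_mw)$, let $\mathfrak{X}\mathfrak{X}^\star w$ be the symmetric $m\times m$ matrix with entries $\frac12(X_iX_jw+X_jX_iw)$, and put $$\mathcal{L}w=-\mathrm{Tr}\big(A(\mathfrak{X}w)\,\mathfrak{X}\mathfrak{X}^\star w\big)+H(\mathfrak{X}w),$$ where $A:\mathbb{R}^m\to\mathbb{R}^{m\times m}$ and $H:\mathbb{R}^m\to\mathbb{R}$ are continuous, $A(\xi)$ is symmetric and positive semi-definite for every $\xi$, $\langle A(\xi)\xi,\xi\rangle>0$ for every $\xi\neq0$, and, for some function $\phi:(0,1]\to(0,\infty)$, $$-\mathrm{Tr}\big(A(t\xi)M\big)\le\frac{-\mathrm{Tr}\big(A(\xi)M\big)}{t\,\phi(1/t)},\qquad H(t\xi)\le\frac{1}{\phi(1/t)}H(\xi)$$ for all $t\ge1$, all $\xi\in\mathbb{R}^m\setminus\{0\}$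 and all symmetric $M\in\mathbb{R}^{m\times m}$. A function $w\in C(\bar\Omega)$ is semi-convex if for some $\Lambda>0$ the function $w(x)+\frac12\Lambda|x|^2$ is convex (on every convex subset of $\Omega$), and semi-concave if $-w$ is semi-convex. The inequality $\mathcal{L}w\le0$ (resp. $\mathcal{L}w\ge0$) holds in the viscosity sense in $\Omega$ if $\mathcal{L}\varphi(x)\le0$ (resp. $\ge0$) for every $x\in\Omega$ and every $\varphi\in C^2(\Omega)$ with $\nabla\varphi(x)\ne0$ such that $w-\varphi$ attains its maximum (resp. minimum) over $\Omega$ at $x$. Let $u,v\in C(\bar\Omega)$ be semi-convex and semi-concave respectively, with $u\le v$ on $\partial\Omega$ and $\mathcal{L}u\le0\le\mathcal{L}v$ in $\Omega$ in the viscosity sense. If $\mathfrak{X}u$ vanishes at no point of $\Omega$ at which $u-v$ attains its maximum over $\Omega$, or if $\mathfrak{X}v$ vanishes at no such point, then $u\le v$ in $\Omega$. -/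

import Mathlib

open scoped Matrix ContDiff

noncomputable section

namespace SubElliptic

/-- Derivative `V f` of a function `f` along a vector field `V` on `ℝⁿ`. -/
def lieD {n : ℕ} (V : EuclideanSpace ℝ (Fin n) → EuclideanSpace ℝ (Fin n))
    (f : EuclideanSpace ℝ (Fin n) → ℝ) : EuclideanSpace ℝ (Fin n) → ℝ :=
  fun x => fderiv ℝ f x (V x)

/-- Sub-elliptic gradient `𝔛 f = (X₁ f, …, X_m f)`. -/
def subGrad {n m : ℕ} (X : Fin m → EuclideanSpace ℝ (Fin n) → EuclideanSpace ℝ (Fin n))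
    (f : EuclideanSpace ℝ (Fin n) → ℝ) (x : EuclideanSpace ℝ (Fin n)) : Fin m → ℝ :=
  fun j => lieD (X j) f x

/-- Symmetrized sub-elliptic second derivative, with entries `(X_i X_j f + X_j X_i f) / 2`. -/
def subHess {n m : ℕ} (X : Fin m → EuclideanSpace ℝ (Fin n) → EuclideanSpace ℝ (Fin n))
    (f : EuclideanSpace ℝ (Fin n) → ℝ) (x : EuclideanSpace ℝ (Fin n)) :
    Matrix (Fin m) (Fin m) ℝ :=
  Matrix.of fun i j => (lieD (X i) (lieD (X j) f) x + lieD (X j) (lieD (X i) f) x) / 2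

/-- The points of `Ω` at which `f` attains its maximum over `Ω`. -/
def argmaxOn {n : ℕ} (Ω : Set (EuclideanSpace ℝ (Fin n))) (f : EuclideanSpace ℝ (Fin n) → ℝ) :
    Set (EuclideanSpace ℝ (Fin n)) :=
  {x | x ∈ Ω ∧ ∀ y ∈ Ω, f y ≤ f x}

/-- The points of `Ω` at which `f` attains its minimum over `Ω`. -/
def argminOn {n : ℕ} (Ω : Set (EuclideanSpace ℝ (Fin n))) (f : EuclideanSpace ℝ (Fin n) → ℝ) :
    Set (EuclideanSpace ℝ (Fin n)) :=
  {x | x ∈ Ω ∧ ∀ y ∈ Ω, f x ≤ f y}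

/-- Test functions touching `w` from above at `x`, with non-zero gradient at `x`. -/
def upperTests {n : ℕ} (Ω : Set (EuclideanSpace ℝ (Fin n))) (w : EuclideanSpace ℝ (Fin n) → ℝ)
    (x : EuclideanSpace ℝ (Fin n)) : Set (EuclideanSpace ℝ (Fin n) → ℝ) :=
  {φ | ContDiffOn ℝ 2 φ Ω ∧ x ∈ argmaxOn Ω (fun y => w y - φ y) ∧ gradient φ x ≠ 0}

/-- Test functions touching `w` from below at `x`, with non-zero gradient at `x`. -/
def lowerTests {n : ℕ} (Ω : Set (EuclideanSpace ℝ (Fin n))) (w : EuclideanSpace ℝ (Fin n) → ℝ)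
    (x : EuclideanSpace ℝ (Fin n)) : Set (EuclideanSpace ℝ (Fin n) → ℝ) :=
  {φ | ContDiffOn ℝ 2 φ Ω ∧ x ∈ argminOn Ω (fun y => w y - φ y) ∧ gradient φ x ≠ 0}

/-- `G(x, w, 𝔛 w, 𝔛𝔛⋆ w) ≤ 0` in `Ω` in the viscosity sense. -/
def IsViscositySubsolution {n m : ℕ}
    (G : EuclideanSpace ℝ (Fin n) → ℝ → (Fin m → ℝ) → Matrix (Fin m) (Fin m) ℝ → ℝ)
    (X : Fin m → EuclideanSpace ℝ (Fin n) → EuclideanSpace ℝ (Fin n))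
    (Ω : Set (EuclideanSpace ℝ (Fin n))) (w : EuclideanSpace ℝ (Fin n) → ℝ) : Prop :=
  UpperSemicontinuousOn w Ω ∧
    ∀ x ∈ Ω, ∀ φ ∈ upperTests Ω w x, G x (φ x) (subGrad X φ x) (subHess X φ x) ≤ 0

/-- `G(x, w, 𝔛 w, 𝔛𝔛⋆ w) ≥ 0` in `Ω` in the viscosity sense. -/
def IsViscositySupersolution {n m : ℕ}
    (G : EuclideanSpace ℝ (Fin n) → ℝ → (Fin m → ℝ) → Matrix (Fin m) (Fin m) ℝ → ℝ)
    (X : Fin m → EuclideanSpace ℝ (Fin n) → EuclideanSpace ℝ (Fin n))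
    (Ω : Set (EuclideanSpace ℝ (Fin n))) (w : EuclideanSpace ℝ (Fin n) → ℝ) : Prop :=
  LowerSemicontinuousOn w Ω ∧
    ∀ x ∈ Ω, ∀ φ ∈ lowerTests Ω w x, 0 ≤ G x (φ x) (subGrad X φ x) (subHess X φ x)

/-- The operator `𝓛 w = -Tr(A(𝔛 w) 𝔛𝔛⋆ w) + H(𝔛 w)`, as a function of `(x, w, 𝔛 w, 𝔛𝔛⋆ w)`. -/
def opL {n m : ℕ} (A : (Fin m → ℝ) → Matrix (Fin m) (Fin m) ℝ) (H : (Fin m → ℝ) → ℝ) :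
    EuclideanSpace ℝ (Fin n) → ℝ → (Fin m → ℝ) → Matrix (Fin m) (Fin m) ℝ → ℝ :=
  fun _ _ ξ M => -(A ξ * M).trace + H ξ

/-- `w + Λ|x|²/2` is convex for some `Λ > 0`. As `Ω` need not be convex, this means convexity
on every convex subset of `Ω` (on `Ω` itself if `Ω` is convex). -/
def IsSemiconvex {n : ℕ} (Ω : Set (EuclideanSpace ℝ (Fin n)))
    (w : EuclideanSpace ℝ (Fin n) → ℝ) : Prop :=
  ∃ Λ : ℝ, 0 < Λ ∧ ∀ s ⊆ Ω, Convex ℝ s → ConvexOn ℝ s (fun x => w x + 1 / 2 * Λ * ‖x‖ ^ 2)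

/-- `w` is semi-concave if `-w` is semi-convex. -/
def IsSemiconcave {n : ℕ} (Ω : Set (EuclideanSpace ℝ (Fin n)))
    (w : EuclideanSpace ℝ (Fin n) → ℝ) : Prop :=
  IsSemiconvex Ω (fun x => -w x)

end SubElliptic

end

/-! Suppose `u > v` somewhere. Then `u - v` has a positive maximum over the closure, attained only
inside `Ω`. The operator has no zeroth-order term, so an ordered pair of second-order jets at such a
point is no contradiction yet; the subsolution must first be made strict. This is done by replacing
`u` with `g(u)`, where `g(s) = s + ε/2 (s - s₀)²` and `s₀ = min u`, so that `t = g'(u) ≥ 1`. A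
gradient `ξ = 𝔛u` and second derivative `M` become `tξ` and `tM + ε ξξᵀ`. The scaling hypotheses
bound the operator at this new jet by `1/φ(1/t)` times its value at `(ξ, M)`, minus `ε⟨A(ξ)ξ,
ξ⟩/(tφ(1/t))`. That is negative as soon as `ξ ≠ 0`, which contradicts the supersolution property of
`v` (`not_ordered_jets`).

Nondegeneracy is assumed only at maximum points of `u - v`. Maximum points of `g(u) - v` converge,
as `ε → 0`, to one of these (`exists_tendsto_argmax`). There `u` and `v` are differentiable with a
common gradient, so either alternative of the hypothesis applies. Gradients of a semiconvex function
are continuous at such a point, hence `𝔛u ≠ 0` survives for small `ε`.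

The jets come from semiconvexity, without doubling of variables. Alexandrov's theorem gives
second-order expansions off a null set, and Jensen's lemma (`exists_affine_contact_notMem`) finds
contact points off that set arbitrarily near the maximum. The Hessians there are ordered up to a
small error (`exists_approx_jets`) and bounded, so they converge along a subsequence to ordered jets
at the maximum itself. Since the limiting gradients are exactly parallel, the first-order terms that
the vector fields contribute to the sub-elliptic Hessians cancel. -/

namespace SubElliptic

open Set Filter Topology MeasureTheory Metric Module
open scoped RealInnerProductSpace NNReal ENNReal

/-! ### Touching paraboloids and the regularity they force -/

section Paraboloids

variable {E : Type*} [NormedAddCommGroup E] [InnerProductSpace ℝ E]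

/-- On `S`, the function `a` lies above a paraboloid of opening `C` touching it at `x`
with gradient `p`. -/
def LowerParab (S : Set E) (a : E → ℝ) (C : ℝ) (x p : E) : Prop :=
  ∀ z ∈ S, a x + ⟪p, z - x⟫ - C * ‖z - x‖ ^ 2 ≤ a z

/-- On `S`, the function `a` lies below a paraboloid of opening `C` touching it at `x`
with gradient `p`. -/
def UpperParab (S : Set E) (a : E → ℝ) (C : ℝ) (x p : E) : Prop :=
  ∀ z ∈ S, a z ≤ a x + ⟪p, z - x⟫ + C * ‖z - x‖ ^ 2

theorem exists_mem_closedBall_inner_eq (x p : E) {s : ℝ} (hs : 0 ≤ s) :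
    ∃ z, ‖z - x‖ ≤ s ∧ ⟪p, z - x⟫ = s * ‖p‖ := by
  by_cases hp : p = 0
  · exact ⟨x, by simp [hs, hp]⟩
  · have hp' : ‖p‖ ≠ 0 := norm_ne_zero_iff.2 hp
    refine ⟨x + (s / ‖p‖) • p, ?_, ?_⟩
    · simp only [add_sub_cancel_left, norm_smul, norm_div, Real.norm_eq_abs, abs_norm,
        abs_of_nonneg hs]
      rw [div_mul_cancel₀ _ hp']
    · simp only [add_sub_cancel_left, inner_smul_right, real_inner_self_eq_norm_sq]
      field_simp

/-- The function is tested at the point `z` at distance at most `s` from `x'` in the direction `p' -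
p`. The lower bounds chained through `x → x' → z` are compared with the upper bound `x → z`. As `‖z
- x‖ ≤ 2s`, the quadratic errors add up to `4 + 1 + 1 = 6` times `C s²`. -/
theorem norm_sub_le_of_parab {S : Set E} {a : E → ℝ} {C s : ℝ} {x p x' p' : E} (hC : 0 ≤ C)
    (hup : UpperParab S a C x p) (hlo : LowerParab S a C x p) (hlo' : LowerParab S a C x' p')
    (hs : 0 < s) (hxx : ‖x' - x‖ ≤ s) (hball : closedBall x' s ⊆ S) :
    ‖p' - p‖ ≤ 6 * C * s := by
  obtain ⟨z, hz, hzi⟩ := exists_mem_closedBall_inner_eq x' (p' - p) hs.le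
  have hzS : z ∈ S := hball (by simpa [dist_eq_norm] using hz)
  have hxS : x' ∈ S := hball (by simp [hs.le])
  have h1 := hup z hzS
  have h2 := hlo x' hxS
  have h3 := hlo' z hzS
  have e : ⟪p, z - x⟫ = ⟪p, z - x'⟫ + ⟪p, x' - x⟫ := by rw [← inner_add_right]; simp
  have e2 : ⟪p' - p, z - x'⟫ = ⟪p', z - x'⟫ - ⟪p, z - x'⟫ := inner_sub_left _ _ _
  have hzx : ‖z - x‖ ≤ 2 * s := by
    calc ‖z - x‖ = ‖(z - x') + (x' - x)‖ := by simp
      _ ≤ _ := norm_add_le _ _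
      _ ≤ 2 * s := by linarith
  have k1 : C * ‖z - x‖ ^ 2 ≤ C * (2 * s) ^ 2 := by gcongr
  have k2 : C * ‖x' - x‖ ^ 2 ≤ C * s ^ 2 := by gcongr
  have k3 : C * ‖z - x'‖ ^ 2 ≤ C * s ^ 2 := by gcongr
  have : s * ‖p' - p‖ ≤ s * (6 * C * s) := by nlinarith
  exact le_of_mul_le_mul_left this hs

/-- Touching gradients depend in a Lipschitz way on the contact point. -/
theorem norm_sub_le_mul_norm_sub_of_parab {S : Set E} {a : E → ℝ} {C r : ℝ} {x p x' p' : E}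
    (hC : 0 ≤ C)
    (hup : UpperParab S a C x p) (hlo : LowerParab S a C x p) (hlo' : LowerParab S a C x' p')
    (hr : ‖x' - x‖ < r) (hball : closedBall x' r ⊆ S) :
    ‖p' - p‖ ≤ 6 * C * ‖x' - x‖ := by
  have h : ∀ s ∈ Ioo ‖x' - x‖ r, ‖p' - p‖ ≤ 6 * C * s := fun s hs =>
    norm_sub_le_of_parab hC hup hlo hlo' ((norm_nonneg _).trans_lt hs.1) hs.1.le
      ((closedBall_subset_closedBall hs.2.le).trans hball)
  -- The estimate needs a radius `s > 0`, so it is proved for `s` above `‖x' - x‖` and passed to the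
  -- limit; this covers `x' = x` too.
  have ht : Tendsto (fun s : ℝ => 6 * C * s) (𝓝[>] ‖x' - x‖) (𝓝 (6 * C * ‖x' - x‖)) :=
    ((continuous_const.mul continuous_id).tendsto _).mono_left nhdsWithin_le_nhds
  exact ge_of_tendsto ht (by filter_upwards [Ioo_mem_nhdsGT hr] with s hs using h s hs)

theorem hasFDerivAt_of_parab {S : Set E} {a : E → ℝ} {C C' : ℝ} {x p : E}
    (hS : S ∈ 𝓝 x) (hup : UpperParab S a C x p) (hlo : LowerParab S a C' x p) :
    HasFDerivAt a (innerSL ℝ p) x := by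
  rw [hasFDerivAt_iff_isLittleO]
  have h1 : (fun z => a z - a x - innerSL ℝ p (z - x)) =O[𝓝 x] fun z => ‖z - x‖ ^ 2 := by
    refine Asymptotics.IsBigO.of_bound (max C C') ?_
    filter_upwards [hS] with z hz
    have h1 := hup z hz
    have h2 := hlo z hz
    have h3 : C * ‖z - x‖ ^ 2 ≤ max C C' * ‖z - x‖ ^ 2 := by gcongr; exact le_max_left _ _
    have h4 : C' * ‖z - x‖ ^ 2 ≤ max C C' * ‖z - x‖ ^ 2 := by gcongr; exact le_max_right _ _
    simp only [innerSL_apply_apply, Real.norm_eq_abs, abs_pow, abs_norm]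
    rw [abs_le]; constructor <;> linarith
  refine h1.trans_isLittleO ?_
  have h2 : (fun z : E => ‖z - x‖ ^ 2) =o[𝓝 x] fun z => ‖z - x‖ := by
    have : Tendsto (fun z : E => ‖z - x‖) (𝓝 x) (𝓝 0) := by
      have : Continuous fun z : E => ‖z - x‖ := by fun_prop
      simpa using this.tendsto x
    simpa [Function.comp_def] using (Asymptotics.isLittleO_pow_id one_lt_two).comp_tendsto this
  exact h2.norm_right.of_norm_right.trans_isBigO (Asymptotics.isBigO_refl _ _).norm_left

end Paraboloids

/-! ### Subgradients of convex functions and the resolvent of the subdifferential -/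

section Subgradients

variable {E : Type*} [NormedAddCommGroup E] [InnerProductSpace ℝ E]

theorem LowerParab.of_local_of_convexOn {S : Set E} {f : E → ℝ} (hf : ConvexOn ℝ S f) {x q : E}
    (hx : x ∈ interior S) (h : ∀ z ∈ interior S, f x + ⟪q, z - x⟫ ≤ f z) :
    LowerParab S f 0 x q := by
  intro z hz
  have hcont : Tendsto (fun t : ℝ => x + t • (z - x)) (𝓝[>] 0) (𝓝 x) := by
    have : Continuous fun t : ℝ => x + t • (z - x) := by fun_prop
    simpa using (this.tendsto 0).mono_left (nhdsWithin_le_nhds (s := Ioi 0))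
  obtain ⟨t, ht, ht1⟩ := ((hcont.eventually (isOpen_interior.mem_nhds hx)).and
    (Ioo_mem_nhdsGT (zero_lt_one (α := ℝ)))).exists
  have h1 := h _ ht
  have h2 := hf.2 (interior_subset hx) hz (sub_nonneg.2 ht1.2.le) ht1.1.le (by ring)
  have e : (1 - t) • x + t • z = x + t • (z - x) := by module
  rw [e] at h2
  simp only [add_sub_cancel_left, inner_smul_right, smul_eq_mul] at h1 h2
  have : t * (f x + ⟪q, z - x⟫) ≤ t * f z := by linarith
  simpa using le_of_mul_le_mul_left this ht1.1

/-- A continuous convex function has a subgradient at every interior point. -/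
theorem exists_subgradient [CompleteSpace E] {S : Set E} {f : E → ℝ} (hf : ConvexOn ℝ S f)
    (hc : ContinuousOn f S) {x : E} (hx : x ∈ interior S) : ∃ q, LowerParab S f 0 x q := by
  have hfi : ConvexOn ℝ (interior S) f := hf.subset interior_subset hf.1.interior
  have hopen : IsOpen {p : E × ℝ | p.1 ∈ interior S ∧ f p.1 < p.2} := by
    have h1 : ContinuousOn (fun p : E × ℝ => f p.1 - p.2) (interior S ×ˢ univ) :=
      ((hc.mono interior_subset).comp continuousOn_fst (fun p hp => hp.1)).sub continuousOn_snd
    have := h1.isOpen_inter_preimage (isOpen_interior.prod isOpen_univ) (isOpen_Iio (a := (0 : ℝ)))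
    convert this using 1
    ext p; simp
  -- A hyperplane separates `(x, f x)` from the open strict epigraph. Its vertical component `c` is
  -- negative, so dividing by `-c` turns its horizontal part into a subgradient.
  obtain ⟨L, hL⟩ := geometric_hahn_banach_open_point (x := (x, f x)) hfi.convex_strict_epigraph
    hopen (by simp)
  set l : E →L[ℝ] ℝ := L.comp (ContinuousLinearMap.inl ℝ E ℝ) with hl
  set c : ℝ := L (0, 1) with hcdef
  have hLs : ∀ z t, L (z, t) = l z + t * c := by
    intro z t
    have : ((z, t) : E × ℝ) = (z, 0) + t • (0, 1) := by simp
    rw [this, map_add, map_smul]; simp [hl, hcdef]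
  have hcneg : c < 0 := by
    have := hL (x, f x + 1) ⟨hx, by simp⟩
    rw [hLs, hLs] at this; linarith
  refine ⟨(-c)⁻¹ • (InnerProductSpace.toDual ℝ E).symm l, .of_local_of_convexOn hf hx ?_⟩
  intro z hz
  have key : l z + f z * c ≤ l x + f x * c := by
    have ht : Tendsto (fun t : ℝ => l z + t * c) (𝓝[>] (f z)) (𝓝 (l z + f z * c)) := by
      have : Continuous fun t : ℝ => l z + t * c := by fun_prop
      exact (this.tendsto _).mono_left nhdsWithin_le_nhds
    refine le_of_tendsto ht ?_
    filter_upwards [self_mem_nhdsWithin] with t ht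
    have := hL (z, t) ⟨hz, ht⟩
    rw [hLs, hLs] at this; exact this.le
  rw [inner_smul_left, InnerProductSpace.toDual_symm_apply, map_sub]
  simp only [conj_trivial]
  have hc' : 0 < -c := by linarith
  have : (-c)⁻¹ * (l z - l x) ≤ f z - f x := by
    rw [inv_mul_le_iff₀ hc']; linarith
  linarith

/-- Every vector is of the form `x + q` with `q` a subgradient at `x`. -/
theorem exists_resolvent {S : Set E} {f : E → ℝ} (hf : ConvexOn ℝ S f) (hS : IsCompact S)
    (hne : S.Nonempty) (hc : ContinuousOn f S) (y : E) : ∃ x ∈ S, LowerParab S f 0 x (y - x) := by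
  obtain ⟨x, hxS, hx⟩ := hS.exists_isMinOn hne
    (f := fun z => f z + 1 / 2 * ‖z - y‖ ^ 2) (hc.add (by fun_prop))
  refine ⟨x, hxS, fun z hz => ?_⟩
  -- The first variation of the minimised function along the segment from `x` to `z`, divided by
  -- `t`; letting `t → 0` removes the quadratic term.
  have h : ∀ t ∈ Ioo (0 : ℝ) 1, 0 ≤ f z - f x - ⟪y - x, z - x⟫ + 1 / 2 * t * ‖z - x‖ ^ 2 := by
    intro t ht
    have e : (1 - t) • x + t • z = x + t • (z - x) := by module
    have h1 := hf.2 hxS hz (sub_nonneg.2 ht.2.le) ht.1.le (by ring)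
    have h2 := hx (hf.1 hxS hz (sub_nonneg.2 ht.2.le) ht.1.le (by ring))
    rw [e] at h1 h2
    simp only [smul_eq_mul, mem_ofPred_eq] at h1 h2
    have e2 : ‖x + t • (z - x) - y‖ ^ 2
        = ‖x - y‖ ^ 2 - 2 * (t * ⟪y - x, z - x⟫) + t ^ 2 * ‖z - x‖ ^ 2 := by
      have : x + t • (z - x) - y = (x - y) + t • (z - x) := by abel
      rw [this, norm_add_sq_real, inner_smul_right, norm_smul, ← neg_sub y x, inner_neg_left,
        mul_pow, Real.norm_eq_abs, sq_abs]
      ring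
    rw [e2] at h2
    have : 0 ≤ t * (f z - f x - ⟪y - x, z - x⟫ + 1 / 2 * t * ‖z - x‖ ^ 2) := by nlinarith
    exact (mul_nonneg_iff_of_pos_left ht.1).1 this
  have ht : Tendsto (fun t : ℝ => f z - f x - ⟪y - x, z - x⟫ + 1 / 2 * t * ‖z - x‖ ^ 2) (𝓝[>] 0)
      (𝓝 (f z - f x - ⟪y - x, z - x⟫ + 1 / 2 * 0 * ‖z - x‖ ^ 2)) := by
    have : Continuous fun t : ℝ => f z - f x - ⟪y - x, z - x⟫ + 1 / 2 * t * ‖z - x‖ ^ 2 := by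
      fun_prop
    exact (this.tendsto 0).mono_left nhdsWithin_le_nhds
  have := ge_of_tendsto ht (by filter_upwards [Ioo_mem_nhdsGT zero_lt_one] with t ht using h t ht)
  simp at this ⊢; linarith

/-- Monotonicity of the subdifferential, `⟪q - q', x - x'⟫ ≥ 0`. It makes `x + q ↦ x` single-valued
and 1-Lipschitz. -/
theorem norm_sub_le_of_subgradient {S : Set E} {f : E → ℝ} {x x' q q' : E} (hx : x ∈ S)
    (hx' : x' ∈ S) (h : LowerParab S f 0 x q) (h' : LowerParab S f 0 x' q') :
    ‖x - x'‖ ≤ ‖(x + q) - (x' + q')‖ := by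
  have h1 := h x' hx'
  have h2 := h' x hx
  have e1 : ⟪q, x' - x⟫ = - ⟪q, x - x'⟫ := by rw [← inner_neg_right, neg_sub]
  have e2 : ⟪(x + q) - (x' + q'), x - x'⟫ = ‖x - x'‖ ^ 2 + ⟪q, x - x'⟫ - ⟪q', x - x'⟫ := by
    rw [← real_inner_self_eq_norm_sq, ← inner_add_left, ← inner_sub_left]; congr 1; abel
  have h3 := real_inner_le_norm ((x + q) - (x' + q')) (x - x')
  have h4 : ‖x - x'‖ * ‖x - x'‖ ≤ ‖(x + q) - (x' + q')‖ * ‖x - x'‖ := by nlinarith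
  rcases (norm_nonneg (x - x')).eq_or_lt with h0 | h0
  · rw [← h0]; positivity
  · exact le_of_mul_le_mul_right h4 h0

end Subgradients

/-! ### Alexandrov's theorem -/

section SecondOrder

/-- A Riemann-sum substitute for integrating `g' ≤ c + sβ`, with no differentiability of `g`.
Summing over `N` equal steps gives `c + (β/2)(1 + 1/N)`. -/
theorem sub_le_of_increment_le {g : ℝ → ℝ} {c β : ℝ}
    (h : ∀ t s, 0 ≤ t → t ≤ s → s ≤ 1 → g s - g t ≤ (s - t) * (c + s * β)) :
    g 1 - g 0 ≤ c + β / 2 := by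
  have key : ∀ N : ℕ, 0 < N → ∀ k : ℕ, k ≤ N →
      g (k / N) - g 0 ≤ (k / N) * c + β * (k * (k + 1)) / (2 * N ^ 2) := by
    intro N hN k
    have hN' : (0 : ℝ) < N := by exact_mod_cast hN
    induction k with
    | zero => intro _; simp
    | succ k ih =>
      intro hk
      have hk' : ((k + 1 : ℕ) : ℝ) ≤ N := by exact_mod_cast hk
      have h1 := ih (by omega)
      have h2 := h (k / N) ((k + 1 : ℕ) / N) (by positivity) (by gcongr; simp)
        (by rw [div_le_one hN']; exact hk')
      have e : (((k + 1 : ℕ) : ℝ) / N - k / N) * (c + ((k + 1 : ℕ) : ℝ) / N * β)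
          + ((k / N) * c + β * (k * (k + 1)) / (2 * N ^ 2))
          = (((k + 1 : ℕ) : ℝ) / N) * c
            + β * (((k + 1 : ℕ) : ℝ) * (((k + 1 : ℕ) : ℝ) + 1)) / (2 * N ^ 2) := by
        push_cast; field_simp; ring
      linarith
  have h2 : ∀ᶠ N : ℕ in atTop, g 1 - g 0 ≤ c + β / 2 * (1 + 1 / (N : ℝ)) := by
    filter_upwards [eventually_gt_atTop 0] with N hN
    have hN' : (0 : ℝ) < N := by exact_mod_cast hN
    have := key N hN N le_rfl
    rw [div_self hN'.ne'] at this
    have e : 1 * c + β * (N * (N + 1)) / (2 * (N : ℝ) ^ 2) = c + β / 2 * (1 + 1 / (N : ℝ)) := by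
      field_simp
    linarith
  have ht : Tendsto (fun N : ℕ => c + β / 2 * (1 + 1 / (N : ℝ))) atTop
      (𝓝 (c + β / 2 * (1 + 0))) :=
    ((tendsto_one_div_atTop_nhds_zero_nat.const_add 1).const_mul _).const_add _
  simpa using ge_of_tendsto ht h2

theorem le_sub_of_le_increment {g : ℝ → ℝ} {c β : ℝ}
    (h : ∀ t s, 0 ≤ t → t ≤ s → s ≤ 1 → (s - t) * (c + t * β) ≤ g s - g t) :
    c + β / 2 ≤ g 1 - g 0 := by
  have := sub_le_of_increment_le (g := fun t => g (1 - t)) (c := -(c + β)) (β := β) ?_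
  · simp at this; linarith
  · intro t s ht hts hs
    have := h (1 - s) (1 - t) (by linarith) (by linarith) (by linarith)
    nlinarith

variable {E : Type*} [NormedAddCommGroup E] [InnerProductSpace ℝ E]

/-- If the subgradients of a convex function have a first-order expansion at `x`, then the function
has a second-order expansion at `x`. -/
theorem abs_quadratic_remainder_le [CompleteSpace E] {S : Set E} {f : E → ℝ}
    (hf : ConvexOn ℝ S f) (hc : ContinuousOn f S) {x q : E} {B : E →L[ℝ] E} {η r : ℝ}
    (hball : ball x r ⊆ S)
    (hq : ∀ z ∈ ball x r, ∀ q', LowerParab S f 0 z q' → ‖q' - q - B (z - x)‖ ≤ η * ‖z - x‖)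
    {z : E} (hz : z ∈ ball x r) :
    |f z - f x - ⟪q, z - x⟫ - 1 / 2 * ⟪B (z - x), z - x⟫| ≤ η / 2 * ‖z - x‖ ^ 2 := by
  set k := z - x with hk
  have hmem : ∀ t : ℝ, 0 ≤ t → t ≤ 1 → x + t • k ∈ ball x r := by
    intro t ht ht1
    rw [mem_ball, dist_eq_norm] at hz ⊢
    rw [add_sub_cancel_left, norm_smul, Real.norm_of_nonneg ht]
    exact (mul_le_of_le_one_left (norm_nonneg _) ht1).trans_lt hz
  have hsub : ∀ t : ℝ, 0 ≤ t → t ≤ 1 → ∃ q', LowerParab S f 0 (x + t • k) q' ∧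
      |⟪q', k⟫ - ⟪q, k⟫ - t * ⟪B k, k⟫| ≤ t * (η * ‖k‖ ^ 2) := by
    intro t ht ht1
    obtain ⟨q', hq'⟩ := exists_subgradient hf hc
      (mem_interior.2 ⟨_, hball, isOpen_ball, hmem t ht ht1⟩)
    refine ⟨q', hq', ?_⟩
    have h1 := hq _ (hmem t ht ht1) q' hq'
    rw [add_sub_cancel_left, norm_smul, Real.norm_of_nonneg ht, map_smul] at h1
    have e : ⟪q', k⟫ - ⟪q, k⟫ - t * ⟪B k, k⟫ = ⟪q' - q - t • B k, k⟫ := by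
      rw [inner_sub_left, inner_sub_left, inner_smul_left]; simp
    rw [e]
    calc |⟪q' - q - t • B k, k⟫| ≤ ‖q' - q - t • B k‖ * ‖k‖ := abs_real_inner_le_norm _ _
      _ ≤ (η * (t * ‖k‖)) * ‖k‖ := by gcongr
      _ = _ := by ring
  have hS : ∀ t : ℝ, 0 ≤ t → t ≤ 1 → x + t • k ∈ S := fun t h h' => hball (hmem t h h')
  have ediff : ∀ s t : ℝ, (x + s • k) - (x + t • k) = (s - t) • k := by intro s t; module
  -- An increment along the segment is bounded above by the subgradient at its right end, and below
  -- (in `hlo`) by the one at its left end.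
  have hup : f (x + (1 : ℝ) • k) - f (x + (0 : ℝ) • k)
      ≤ ⟪q, k⟫ + (⟪B k, k⟫ + η * ‖k‖ ^ 2) / 2 := by
    refine sub_le_of_increment_le (g := fun t => f (x + t • k)) fun t s ht hts hs => ?_
    obtain ⟨q', hq', hb⟩ := hsub s (ht.trans hts) hs
    have h1 := hq' _ (hS t ht (hts.trans hs))
    rw [ediff, inner_smul_right] at h1
    have h2 := (abs_le.1 hb).2
    have h3 : (s - t) * ⟪q', k⟫ ≤ (s - t) * (⟪q, k⟫ + s * (⟪B k, k⟫ + η * ‖k‖ ^ 2)) :=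
      mul_le_mul_of_nonneg_left (by linarith) (by linarith)
    linarith
  have hlo : ⟪q, k⟫ + (⟪B k, k⟫ - η * ‖k‖ ^ 2) / 2
      ≤ f (x + (1 : ℝ) • k) - f (x + (0 : ℝ) • k) := by
    refine le_sub_of_le_increment (g := fun t => f (x + t • k)) fun t s ht hts hs => ?_
    obtain ⟨q', hq', hb⟩ := hsub t ht (hts.trans hs)
    have h1 := hq' _ (hS s (ht.trans hts) hs)
    rw [ediff, inner_smul_right] at h1
    have h2 := (abs_le.1 hb).1
    have h3 : (s - t) * (⟪q, k⟫ + t * (⟪B k, k⟫ - η * ‖k‖ ^ 2)) ≤ (s - t) * ⟪q', k⟫ :=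
      mul_le_mul_of_nonneg_left (by linarith) (by linarith)
    linarith
  have ez : x + (1 : ℝ) • k = z := by simp [hk]
  rw [ez, zero_smul, add_zero] at hup hlo
  rw [abs_le]; constructor <;> linarith

/-- Differentiability of the resolvent of the subdifferential at `x + q` yields a first-order
expansion of the subgradients at a point `x` which is touched from both sides. -/
theorem exists_subgradient_expansion [FiniteDimensional ℝ E] {S : Set E} {f : E → ℝ} {J : E → E}
    (hJS : ∀ y, J y ∈ S) (hJ : ∀ y, LowerParab S f 0 (J y) (y - J y)) {x q : E} {C : ℝ}
    (hC : 0 ≤ C) (hx : x ∈ interior S) (hlo : LowerParab S f 0 x q) (hup : UpperParab S f C x q)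
    (hd : DifferentiableAt ℝ J (x + q)) :
    ∃ B : E →L[ℝ] E, ∀ η > 0, ∃ r > 0, ball x r ⊆ S ∧ ∀ z ∈ ball x r, ∀ q',
      LowerParab S f 0 z q' → ‖q' - q - B (z - x)‖ ≤ η * ‖z - x‖ := by
  obtain ⟨D, hD⟩ := hd
  obtain ⟨ρ, hρ, hρS⟩ := Metric.nhds_basis_closedBall.mem_iff.1 (mem_interior_iff_mem_nhds.1 hx)
  have weaken : ∀ {z p}, LowerParab S f 0 z p → LowerParab S f C z p := by
    intro z p h y hy
    have := h y hy
    have : 0 ≤ C * ‖y - z‖ ^ 2 := by positivity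
    linarith
  have hJeq : ∀ z ∈ S, ∀ q', LowerParab S f 0 z q' → J (z + q') = z := by
    intro z hz q' h
    have := norm_sub_le_of_subgradient (hJS (z + q')) hz (hJ _) h
    simpa [sub_eq_zero] using this
  have hgrad : ∀ z ∈ ball x (ρ / 2), ∀ q', LowerParab S f 0 z q' →
      ‖q' - q‖ ≤ 6 * C * ‖z - x‖ := by
    intro z hz q' h
    refine norm_sub_le_mul_norm_sub_of_parab hC hup (weaken hlo) (weaken h)
      (by simpa [dist_eq_norm] using hz) ((closedBall_subset_closedBall' ?_).trans hρS)
    have := mem_ball.1 hz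
    linarith
  -- Because `f` is touched from both sides at `x`, the map `z ↦ z + q'` has linear growth at `x`.
  -- Its inverse `J` therefore cannot contract too much, and this forces its derivative `D` to be
  -- injective.
  have hsum : ∀ z ∈ ball x (ρ / 2), ∀ q', LowerParab S f 0 z q' →
      ‖(z + q') - (x + q)‖ ≤ (1 + 6 * C) * ‖z - x‖ := by
    intro z hz q' h
    calc ‖(z + q') - (x + q)‖ = ‖(z - x) + (q' - q)‖ := by congr 1; abel
      _ ≤ ‖z - x‖ + ‖q' - q‖ := norm_add_le _ _
      _ ≤ _ := by linarith [hgrad z hz q' h]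
  have hJx : J (x + q) = x := hJeq x (interior_subset hx) q hlo
  have hDinj : Function.Injective D := by
    rw [injective_iff_map_eq_zero]
    intro k hk
    have hJc : Tendsto (fun t : ℝ => J (x + q + t • k)) (𝓝[>] 0) (𝓝 x) := by
      have h1 : Tendsto (fun t : ℝ => x + q + t • k) (𝓝[>] 0) (𝓝 (x + q)) := by
        have : Continuous fun t : ℝ => x + q + t • k := by fun_prop
        simpa using (this.tendsto 0).mono_left (nhdsWithin_le_nhds (s := Ioi 0))
      have := hD.continuousAt.tendsto.comp h1
      rwa [hJx] at this
    have hlim : Tendsto (fun t : ℝ => t⁻¹ • (J (x + q + t • k) - J (x + q))) (𝓝[>] 0)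
        (𝓝 (D k)) := by
      have h1 := (hD.hasLineDerivAt k).tendsto_slope_zero
      exact h1.mono_left (nhdsWithin_mono _ (fun t ht => ne_of_gt ht))
    have hb : ∀ᶠ t : ℝ in 𝓝[>] 0,
        ‖k‖ ≤ (1 + 6 * C) * ‖t⁻¹ • (J (x + q + t • k) - J (x + q))‖ := by
      filter_upwards [hJc (ball_mem_nhds x (half_pos hρ)), self_mem_nhdsWithin] with t ht ht0
      have ht0 : 0 < t := ht0
      have h1 := hsum _ ht _ (hJ (x + q + t • k))
      rw [add_sub_cancel, add_sub_cancel_left, norm_smul, Real.norm_of_nonneg ht0.le] at h1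
      rw [hJx, norm_smul, norm_inv, Real.norm_of_nonneg ht0.le]
      have : ‖k‖ = t⁻¹ * (t * ‖k‖) := by field_simp
      rw [this]
      calc t⁻¹ * (t * ‖k‖) ≤ t⁻¹ * ((1 + 6 * C) * ‖J (x + q + t • k) - x‖) := by gcongr
        _ = _ := by ring
    have := ge_of_tendsto (hlim.norm.const_mul (1 + 6 * C)) hb
    rw [hk] at this
    simpa using this
  obtain ⟨G, hG⟩ := D.toLinearMap.exists_leftInverse_of_injective (LinearMap.ker_eq_bot.2 hDinj)
  set G' : E →L[ℝ] E := LinearMap.toContinuousLinearMap G with hG'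
  have hGD : ∀ k, G' (D k) = k := fun k => by
    have := LinearMap.congr_fun hG k
    simpa [hG'] using this
  -- Since `J` inverts `id + ∂f`, the derivative of the subgradient should be `D⁻¹ - id`.
  refine ⟨G' - ContinuousLinearMap.id ℝ E, fun η hη => ?_⟩
  set ε : ℝ := η / ((‖G'‖ + 1) * (1 + 6 * C)) with hε
  have hε0 : 0 < ε := by positivity
  obtain ⟨s, hs, hsb⟩ := Metric.eventually_nhds_iff_ball.1
    ((hasFDerivAt_iff_isLittleO.1 hD).def hε0)
  refine ⟨min (ρ / 2) (s / (1 + 6 * C)), by positivity, ?_, ?_⟩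
  · exact (ball_subset_closedBall.trans (closedBall_subset_closedBall
      ((min_le_left _ _).trans (by linarith)))).trans hρS
  intro z hz q' h
  have hz1 : z ∈ ball x (ρ / 2) := ball_subset_ball (min_le_left _ _) hz
  have hz2 : ‖z - x‖ < s / (1 + 6 * C) := by
    simpa [dist_eq_norm] using ball_subset_ball (min_le_right _ _) hz
  have hzS : z ∈ S := hρS (ball_subset_closedBall (ball_subset_ball (by linarith) hz1))
  have h1 := hsum z hz1 q' h
  have h2 := hsb (z + q') (by
    rw [mem_ball, dist_eq_norm]
    refine h1.trans_lt ?_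
    rw [lt_div_iff₀ (by positivity)] at hz2
    linarith)
  rw [hJeq z hzS q' h, hJx] at h2
  have e : q' - q - (G' - ContinuousLinearMap.id ℝ E) (z - x)
      = - G' (z - x - D (z + q' - (x + q))) := by
    simp only [map_sub, hGD, _root_.sub_apply, ContinuousLinearMap.id_apply, map_add]
    abel
  rw [e, norm_neg]
  calc ‖G' (z - x - D (z + q' - (x + q)))‖
      ≤ ‖G'‖ * ‖z - x - D (z + q' - (x + q))‖ := G'.le_opNorm _
    _ ≤ (‖G'‖ + 1) * (ε * ((1 + 6 * C) * ‖z - x‖)) := by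
        gcongr
        · linarith
        · exact h2.trans (by gcongr)
    _ = η * ‖z - x‖ := by rw [hε]; field_simp

/-- The function `f` has the second-order expansion with gradient `q` and Hessian `B` at `x`. -/
def HasSecondOrderExpansion (f : E → ℝ) (q : E) (B : E →L[ℝ] E) (x : E) : Prop :=
  ∀ η > 0, ∀ᶠ z in 𝓝 x,
    |f z - f x - ⟪q, z - x⟫ - 1 / 2 * ⟪B (z - x), z - x⟫| ≤ η * ‖z - x‖ ^ 2

/-- Alexandrov's theorem: outside a null set, a convex function has a second-order expansion at
every point at which it is touched by a paraboloid from above. -/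
theorem exists_null_forall_hasSecondOrderExpansion [FiniteDimensional ℝ E] [MeasurableSpace E]
    [BorelSpace E] {S : Set E} {f : E → ℝ} (hf : ConvexOn ℝ S f) (hS : IsCompact S)
    (hc : ContinuousOn f S) :
    ∃ N : Set E, μH[finrank ℝ E] N = 0 ∧ ∀ x ∈ interior S, x ∉ N → ∀ q C, 0 ≤ C →
      LowerParab S f 0 x q → UpperParab S f C x q →
      ∃ B : E →L[ℝ] E, (∀ a b, ⟪B a, b⟫ = ⟪B b, a⟫) ∧ HasSecondOrderExpansion f q B x := by
  rcases S.eq_empty_or_nonempty with rfl | hne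
  · exact ⟨∅, by simp, by simp⟩
  choose J hJS hJ using exists_resolvent hf hS hne hc
  have hJl : LipschitzWith 1 J := by
    refine LipschitzWith.of_dist_le_mul fun y y' => ?_
    have := norm_sub_le_of_subgradient (hJS y) (hJS y') (hJ y) (hJ y')
    simpa [dist_eq_norm] using this
  -- By Rademacher the non-differentiability set of `J` is null, and so is its image under the
  -- 1-Lipschitz map `J`. Hausdorff measure of full dimension is used for its behaviour under
  -- Lipschitz maps.
  refine ⟨J '' {y | ¬ DifferentiableAt ℝ J y}, ?_, ?_⟩
  · have h0 : μH[finrank ℝ E] {y | ¬ DifferentiableAt ℝ J y} = 0 :=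
      ae_iff.1 (hJl.ae_differentiableAt (μ := μH[finrank ℝ E]))
    have := hJl.hausdorffMeasure_image_le (d := finrank ℝ E) (by positivity)
      {y | ¬ DifferentiableAt ℝ J y}
    rw [h0, mul_zero] at this
    exact le_antisymm this zero_le
  · intro x hx hxN q C hC hlo hup
    have hJx : J (x + q) = x := by
      have := norm_sub_le_of_subgradient (hJS (x + q)) (interior_subset hx) (hJ _) hlo
      simpa [sub_eq_zero] using this
    have hd : DifferentiableAt ℝ J (x + q) := by
      by_contra h
      exact hxN ⟨x + q, h, hJx⟩
    obtain ⟨B, hB⟩ := exists_subgradient_expansion hJS hJ hC hx hlo hup hd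
    -- Only the quadratic form of `B` enters the expansion, so `B` may be symmetrised.
    refine ⟨(1 / 2 : ℝ) • (B + B.adjoint), fun a b => ?_, fun η hη => ?_⟩
    · simp only [_root_.smul_apply, _root_.add_apply, inner_smul_left,
        inner_add_left, ContinuousLinearMap.adjoint_inner_left, real_inner_comm]
      ring
    · obtain ⟨r, hr, hrS, hb⟩ := hB η hη
      filter_upwards [ball_mem_nhds x hr] with z hz
      have := abs_quadratic_remainder_le hf hc hrS hb hz
      have e : ⟪((1 / 2 : ℝ) • (B + B.adjoint)) (z - x), z - x⟫ = ⟪B (z - x), z - x⟫ := by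
        simp only [_root_.smul_apply, _root_.add_apply, inner_smul_left,
          inner_add_left, ContinuousLinearMap.adjoint_inner_left]
        rw [real_inner_comm (B (z - x))]
        simp; ring
      rw [e]
      refine this.trans ?_
      gcongr; linarith

end SecondOrder

/-! ### Jensen's lemma and manipulation of second-order expansions -/

section Contact

variable {E : Type*} [NormedAddCommGroup E] [InnerProductSpace ℝ E]

theorem LowerParab.mono {S : Set E} {a : E → ℝ} {C C' : ℝ} {x p : E} (h : LowerParab S a C x p)
    (hC : C ≤ C') : LowerParab S a C' x p := fun z hz => by
  have h1 := h z hz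
  have : C * ‖z - x‖ ^ 2 ≤ C' * ‖z - x‖ ^ 2 := by gcongr
  linarith

theorem UpperParab.mono {S : Set E} {a : E → ℝ} {C C' : ℝ} {x p : E} (h : UpperParab S a C x p)
    (hC : C ≤ C') : UpperParab S a C' x p := fun z hz => by
  have h1 := h z hz
  have : C * ‖z - x‖ ^ 2 ≤ C' * ‖z - x‖ ^ 2 := by gcongr
  linarith

theorem eq_of_parab {S : Set E} {a : E → ℝ} {C C' : ℝ} {x p p' : E} (hx : S ∈ 𝓝 x)
    (hlo : LowerParab S a C x p) (hup : UpperParab S a C' x p') : p = p' := by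
  obtain ⟨r, hr, hrS⟩ := Metric.nhds_basis_closedBall.mem_iff.1 hx
  set M : ℝ := max (C + C') 0
  have h : ∀ s ∈ Ioo (0 : ℝ) r, ‖p - p'‖ ≤ M * s := by
    intro s hs
    obtain ⟨z, hz, hzi⟩ := exists_mem_closedBall_inner_eq x (p - p') hs.1.le
    have hzS : z ∈ S := hrS (by simpa [dist_eq_norm] using hz.trans hs.2.le)
    have h1 := hlo z hzS
    have h2 := hup z hzS
    rw [inner_sub_left] at hzi
    have h3 : (C + C') * ‖z - x‖ ^ 2 ≤ M * s ^ 2 := by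
      calc (C + C') * ‖z - x‖ ^ 2 ≤ M * ‖z - x‖ ^ 2 := by gcongr; exact le_max_left _ _
        _ ≤ M * s ^ 2 := by gcongr
    exact le_of_mul_le_mul_left (by linarith : s * ‖p - p'‖ ≤ s * (M * s)) hs.1
  have ht : Tendsto (fun s : ℝ => M * s) (𝓝[>] 0) (𝓝 (M * 0)) :=
    ((continuous_const.mul continuous_id).tendsto _).mono_left nhdsWithin_le_nhds
  have := ge_of_tendsto ht (by filter_upwards [Ioo_mem_nhdsGT hr] with s hs using h s hs)
  simpa [sub_eq_zero] using this

/-- Jensen's lemma: the points at which a semiconvex function with a strict maximum at `x₀` is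
touched from above by an affine function of small slope are not contained in a null set. -/
theorem exists_affine_contact_notMem [FiniteDimensional ℝ E] [MeasurableSpace E] [BorelSpace E]
    {x₀ : E} {R κ C ρ : ℝ} {w : E → ℝ} {N : Set E} (hκ : 0 < κ) (hC : 0 ≤ C) (hρ : 0 < ρ)
    (hρR : ρ ≤ R / 4) (hw : ContinuousOn w (closedBall x₀ R))
    (hlow : ∀ x ∈ ball x₀ R, ∃ p, LowerParab (closedBall x₀ R) w C x p)
    (hmax : ∀ z ∈ closedBall x₀ R, w z ≤ w x₀ - κ * ‖z - x₀‖ ^ 2)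
    (hN : μH[finrank ℝ E] N = 0) :
    ∃ x P, ‖x - x₀‖ ≤ ρ ∧ x ∉ N ∧ UpperParab (closedBall x₀ R) w 0 x P := by
  set S := closedBall x₀ R with hS
  set K : Set E := {x | ‖x - x₀‖ ≤ ρ ∧ ∃ P, UpperParab S w 0 x P} with hK
  by_contra! hcon
  have hKN : K ⊆ N := fun x hx => by
    by_contra hxN
    obtain ⟨P, hP⟩ := hx.2
    exact hcon x P hx.1 hxN hP
  have hball : ∀ x ∈ K, x ∈ ball x₀ R := fun x hx => by
    rw [mem_ball, dist_eq_norm]; linarith [hx.1]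
  have hnhds : ∀ x ∈ K, S ∈ 𝓝 x := fun x hx =>
    mem_of_superset (isOpen_ball.mem_nhds (hball x hx)) ball_subset_closedBall
  choose! Pf hPf using fun x (hx : x ∈ K) => hx.2
  have hPlow : ∀ x ∈ K, LowerParab S w C x (Pf x) := by
    intro x hx
    obtain ⟨p, hp⟩ := hlow x (hball x hx)
    rwa [← eq_of_parab (hnhds x hx) hp (hPf x hx)]
  -- On the contact set `w` is touched from both sides, so its gradient is Lipschitz there. The
  -- radius `3ρ` exceeds `‖x - y‖ ≤ 2ρ` and, as `ρ ≤ R/4`, keeps the ball inside `S`.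
  have hLip : LipschitzOnWith (6 * C).toNNReal Pf K := by
    refine LipschitzOnWith.of_dist_le_mul fun x hx y hy => ?_
    rw [dist_eq_norm, dist_eq_norm, Real.coe_toNNReal _ (by positivity)]
    refine norm_sub_le_mul_norm_sub_of_parab (r := 3 * ρ) hC ((hPf y hy).mono hC) (hPlow y hy)
      (hPlow x hx) ?_ (closedBall_subset_closedBall' ?_)
    · calc ‖x - y‖ = ‖(x - x₀) - (y - x₀)‖ := by congr 1; abel
        _ ≤ ‖x - x₀‖ + ‖y - x₀‖ := norm_sub_le _ _
        _ < 3 * ρ := by linarith [hx.1, hy.1]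
    · rw [dist_eq_norm]; linarith [hx.1]
  -- For a slope `‖P‖ < κρ`, the term `-κ‖z - x₀‖²` beats the tilt beyond distance `ρ`, so the
  -- tilted function attains its maximum within `ρ` of `x₀`, at a contact point with slope `P`.
  have hcover : ball 0 (κ * ρ) ⊆ Pf '' K := by
    intro P hP
    rw [mem_ball_zero_iff] at hP
    have hx₀S : x₀ ∈ S := mem_closedBall_self (by linarith)
    obtain ⟨x, hxS, hx⟩ := (isCompact_closedBall x₀ R).exists_isMaxOn ⟨x₀, hx₀S⟩
      (f := fun z => w z - ⟪P, z⟫) (hw.sub (by fun_prop))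
    have hup : UpperParab S w 0 x P := fun z hz => by
      have := hx hz
      simp only [mem_ofPred_eq] at this
      rw [inner_sub_right]; linarith
    have h1 := hup x₀ hx₀S
    have h2 := hmax x hxS
    have h3 : ⟪P, x₀ - x⟫ = - ⟪P, x - x₀⟫ := by rw [← inner_neg_right, neg_sub]
    have h4 := neg_le_of_abs_le (abs_real_inner_le_norm P (x - x₀))
    have hxρ : ‖x - x₀‖ ≤ ρ := by
      by_contra! hlt
      have hpos : 0 < ‖x - x₀‖ := hρ.trans hlt
      have h5 : ‖P‖ * ‖x - x₀‖ < (κ * ρ) * ‖x - x₀‖ := by gcongr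
      have h6 : (κ * ρ) * ‖x - x₀‖ ≤ κ * ‖x - x₀‖ * ‖x - x₀‖ := by gcongr
      have h7 : κ * ‖x - x₀‖ ^ 2 = κ * ‖x - x₀‖ * ‖x - x₀‖ := by ring
      linarith
    have hxK : x ∈ K := ⟨hxρ, P, hup⟩
    exact ⟨x, hxK, eq_of_parab (hnhds x hxK) (hPlow x hxK) hup⟩
  -- If the contact set were null, its Lipschitz image would be null, yet that image contains a
  -- ball.
  have h0 : μH[finrank ℝ E] (ball (0 : E) (κ * ρ)) = 0 := by
    refine measure_mono_null hcover (le_antisymm ?_ zero_le)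
    have := hLip.hausdorffMeasure_image_le (d := finrank ℝ E) (by positivity)
    rwa [measure_mono_null hKN hN, mul_zero] at this
  exact (measure_ball_pos (μH[finrank ℝ E]) (0 : E) (mul_pos hκ hρ)).ne' h0

theorem HasSecondOrderExpansion.tendsto_ray {f : E → ℝ} {q : E} {B : E →L[ℝ] E} {x : E}
    (h : HasSecondOrderExpansion f q B x) (e : E) :
    Tendsto (fun s : ℝ => (f (x + s • e) - f x - s * ⟪q, e⟫) / s ^ 2) (𝓝[>] 0)
      (𝓝 (1 / 2 * ⟪B e, e⟫)) := by
  rw [Metric.tendsto_nhds]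
  intro δ hδ
  have hc : Tendsto (fun s : ℝ => x + s • e) (𝓝[>] 0) (𝓝 x) := by
    have : Continuous fun s : ℝ => x + s • e := by fun_prop
    simpa using (this.tendsto 0).mono_left (nhdsWithin_le_nhds (s := Ioi 0))
  have hη : 0 < δ / (‖e‖ ^ 2 + 1) := by positivity
  filter_upwards [hc.eventually (h _ hη), self_mem_nhdsWithin] with s hs hs0
  have hs0 : 0 < s := hs0
  simp only [add_sub_cancel_left, inner_smul_right, map_smul, inner_smul_left, norm_smul,
    Real.norm_of_nonneg hs0.le, conj_trivial] at hs
  rw [Real.dist_eq]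
  have e1 : (f (x + s • e) - f x - s * ⟪q, e⟫) / s ^ 2 - 1 / 2 * ⟪B e, e⟫
      = (f (x + s • e) - f x - s * ⟪q, e⟫ - 1 / 2 * (s * (s * ⟪B e, e⟫))) / s ^ 2 := by
    field_simp
  rw [e1, abs_div, abs_of_pos (by positivity : 0 < s ^ 2), div_lt_iff₀ (by positivity)]
  refine hs.trans_lt ?_
  have : δ / (‖e‖ ^ 2 + 1) * (s * ‖e‖) ^ 2 = (δ * s ^ 2) * (‖e‖ ^ 2 / (‖e‖ ^ 2 + 1)) := by
    field_simp
  rw [this]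
  exact mul_lt_of_lt_one_right (by positivity) (by rw [div_lt_one (by positivity)]; linarith)

theorem HasSecondOrderExpansion.inner_nonneg {S : Set E} {f : E → ℝ} {q : E} {B : E →L[ℝ] E}
    {x : E} (h : HasSecondOrderExpansion f q B x) (hS : S ∈ 𝓝 x) (hlo : LowerParab S f 0 x q)
    (e : E) : 0 ≤ ⟪B e, e⟫ := by
  have hc : Tendsto (fun s : ℝ => x + s • e) (𝓝[>] 0) (𝓝 x) := by
    have : Continuous fun s : ℝ => x + s • e := by fun_prop
    simpa using (this.tendsto 0).mono_left (nhdsWithin_le_nhds (s := Ioi 0))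
  have := ge_of_tendsto (h.tendsto_ray e) (b := 0) (by
    filter_upwards [hc.eventually hS] with s hs
    have := hlo _ hs
    rw [add_sub_cancel_left, inner_smul_right] at this
    exact div_nonneg (by linarith) (by positivity))
  linarith

theorem HasSecondOrderExpansion.neg {f : E → ℝ} {q : E} {B : E →L[ℝ] E} {x : E}
    (h : HasSecondOrderExpansion (fun z => -f z) q B x) :
    HasSecondOrderExpansion f (-q) (-B) x := fun η hη => by
  filter_upwards [h η hη] with z hz
  rw [← abs_neg] at hz
  convert hz using 2
  simp only [inner_neg_left, _root_.neg_apply]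
  ring

theorem norm_sq_sub_norm_sq (x z : E) :
    ‖z‖ ^ 2 - ‖x‖ ^ 2 = 2 * ⟪x, z - x⟫ + ‖z - x‖ ^ 2 := by
  have : z = x + (z - x) := by abel
  conv_lhs => rw [this, norm_add_sq_real]
  ring

theorem HasSecondOrderExpansion.sub_norm_sq {f : E → ℝ} {q : E} {B : E →L[ℝ] E} {x : E} {Λ : ℝ}
    (h : HasSecondOrderExpansion (fun z => f z + 1 / 2 * Λ * ‖z‖ ^ 2) q B x) :
    HasSecondOrderExpansion f (q - Λ • x) (B - Λ • ContinuousLinearMap.id ℝ E) x :=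
  fun η hη => by
  filter_upwards [h η hη] with z hz
  convert hz using 2
  simp only [inner_sub_left, _root_.sub_apply, _root_.smul_apply, inner_smul_left,
    ContinuousLinearMap.id_apply, conj_trivial]
  have h1 := norm_sq_sub_norm_sq x z
  have h2 := real_inner_self_eq_norm_sq (z - x)
  rw [inner_sub_left] at h2
  linear_combination (-Λ / 2) * h1 + (Λ / 2) * h2

/-- Passes between subgradients of `f + Λ|·|²/2` and paraboloids of opening `Λ/2` below the
semiconvex `f`. -/
theorem lowerParab_sub_norm_sq_iff {S : Set E} {f : E → ℝ} {q x : E} {Λ : ℝ} :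
    LowerParab S f (Λ / 2) x (q - Λ • x) ↔
      LowerParab S (fun z => f z + 1 / 2 * Λ * ‖z‖ ^ 2) 0 x q := by
  refine forall₂_congr fun z hz => ?_
  have := norm_sq_sub_norm_sq x z
  simp only [inner_sub_left, inner_smul_left, conj_trivial]
  rw [← sub_nonneg, ← sub_nonneg (b := _ + _ - 0 * _)]
  have e : f z - (f x + (⟪q, z - x⟫ - Λ * ⟪x, z - x⟫) - Λ / 2 * ‖z - x‖ ^ 2)
     = f z + 1 / 2 * Λ * ‖z‖ ^ 2 - (f x + 1 / 2 * Λ * ‖x‖ ^ 2 + ⟪q, z - x⟫ - 0 * ‖z - x‖ ^ 2) := by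
    linear_combination (-Λ / 2) * this
  rw [e]

theorem UpperParab.add_norm_sq {S : Set E} {f : E → ℝ} {q x : E} {C Λ : ℝ}
    (h : UpperParab S f C x (q - Λ • x)) :
    UpperParab S (fun z => f z + 1 / 2 * Λ * ‖z‖ ^ 2) (C + Λ / 2) x q := fun z hz => by
  have h1 := h z hz
  have := norm_sq_sub_norm_sq x z
  simp only [inner_sub_left, inner_smul_left, conj_trivial] at h1
  linear_combination h1 + (Λ / 2) * this

end Contact

/-! ### Jets at maxima of `convexify (u) - v` -/

section Jets

variable {E : Type*} [NormedAddCommGroup E] [InnerProductSpace ℝ E]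

/-- The increasing (on `[s₀, ∞)`) convex change of the dependent variable. -/
noncomputable def convexify (ε s₀ s : ℝ) : ℝ := s + ε / 2 * (s - s₀) ^ 2

/-- The derivative of `convexify`. -/
noncomputable def convexifyDeriv (ε s₀ s : ℝ) : ℝ := 1 + ε * (s - s₀)

theorem convexify_sub (ε s₀ s s' : ℝ) : convexify ε s₀ s' - convexify ε s₀ s =
    convexifyDeriv ε s₀ s * (s' - s) + ε / 2 * (s' - s) ^ 2 := by
  unfold convexify convexifyDeriv; ring

theorem one_le_convexifyDeriv {ε s₀ s : ℝ} (hε : 0 ≤ ε) (hs : s₀ ≤ s) :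
    1 ≤ convexifyDeriv ε s₀ s := by
  have := mul_nonneg hε (sub_nonneg.2 hs)
  unfold convexifyDeriv; linarith

theorem mul_sub_le_convexify_sub {ε s₀ s s' : ℝ} (hε : 0 ≤ ε) :
    convexifyDeriv ε s₀ s * (s' - s) ≤ convexify ε s₀ s' - convexify ε s₀ s := by
  rw [convexify_sub]
  have : 0 ≤ ε / 2 * (s' - s) ^ 2 := by positivity
  linarith

theorem norm_sub_sq_sub_norm_sub_sq (x₀ x z : E) :
    ‖z - x₀‖ ^ 2 - ‖x - x₀‖ ^ 2 = 2 * ⟪x - x₀, z - x⟫ + ‖z - x‖ ^ 2 := by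
  have := norm_sq_sub_norm_sq (x - x₀) (z - x₀)
  rwa [sub_sub_sub_cancel_right] at this

/-- At a contact point the sum of the two functions is bounded above. A lower paraboloid for either
one thus yields an upper paraboloid for the other, and uniqueness of touching gradients gives the
relation between `p` and `q`. Dividing by the slope of `convexify` costs nothing because it is at
least 1. -/
theorem contact_parab {S : Set E} {u v : E → ℝ} {Λ ε s₀ κ C : ℝ} {x₀ x P p q : E} (hε : 0 ≤ ε)
    (hΛ : 0 ≤ Λ) (hκ : 0 ≤ κ) (hx : S ∈ 𝓝 x) (hs : s₀ ≤ u x)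
    (hu : LowerParab S u (Λ / 2) x p) (hv : LowerParab S (fun z => -v z) (Λ / 2) x q)
    (hW : UpperParab S (fun z => convexify ε s₀ (u z) - v z - κ * ‖z - x₀‖ ^ 2) 0 x P)
    (hC : convexifyDeriv ε s₀ (u x) * (Λ / 2) + κ ≤ C) :
    UpperParab S u C x p ∧ UpperParab S (fun z => -v z) C x q ∧
      convexifyDeriv ε s₀ (u x) • p + q = P + (2 * κ) • (x - x₀) := by
  set t := convexifyDeriv ε s₀ (u x) with ht
  have ht1 : 1 ≤ t := one_le_convexifyDeriv hε hs
  have ht0 : 0 < t := by linarith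
  have hC1 : Λ / 2 + κ ≤ C := by nlinarith
  have hC0 : 0 ≤ C := by linarith
  have hup : UpperParab S u C x (t⁻¹ • (P - q + (2 * κ) • (x - x₀))) := by
    intro z hz
    have h1 := hW z hz
    have h2 := hv z hz
    have h3 := norm_sub_sq_sub_norm_sub_sq x₀ x z
    have h4 := mul_sub_le_convexify_sub (s₀ := s₀) (s := u x) (s' := u z) hε
    rw [← ht] at h4
    have h5 : (Λ / 2 + κ) * ‖z - x‖ ^ 2 ≤ C * ‖z - x‖ ^ 2 := by gcongr
    have h6 : t * (u z - u x) ≤ ⟪P - q + (2 * κ) • (x - x₀), z - x⟫ + C * ‖z - x‖ ^ 2 := by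
      rw [inner_add_left, inner_sub_left, inner_smul_left]
      simp only [conj_trivial]
      linear_combination h1 + h2 + h4 + κ * h3 + h5
    rw [inner_smul_left]
    simp only [conj_trivial]
    have h7 : t⁻¹ * (C * ‖z - x‖ ^ 2) ≤ C * ‖z - x‖ ^ 2 :=
      mul_le_of_le_one_left (by positivity) (inv_le_one_of_one_le₀ ht1)
    have h8 : u z - u x ≤ t⁻¹ * (⟪P - q + (2 * κ) • (x - x₀), z - x⟫ + C * ‖z - x‖ ^ 2) := by
      rw [← div_eq_inv_mul, le_div_iff₀ ht0]; linarith
    linarith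
  have hp := eq_of_parab hx hu hup
  have hsum : t • p + q = P + (2 * κ) • (x - x₀) := by
    rw [hp, smul_inv_smul₀ ht0.ne']; abel
  refine ⟨hp ▸ hup, ?_, hsum⟩
  intro z hz
  have h1 := hW z hz
  have h2 := mul_le_mul_of_nonneg_left (hu z hz) ht0.le
  have h3 := norm_sub_sq_sub_norm_sub_sq x₀ x z
  have h4 := mul_sub_le_convexify_sub (s₀ := s₀) (s := u x) (s' := u z) hε
  rw [← ht] at h4
  have h5 : (t * (Λ / 2) + κ) * ‖z - x‖ ^ 2 ≤ C * ‖z - x‖ ^ 2 := by gcongr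
  have h6 := congrArg (fun y => ⟪y, z - x⟫) hsum
  simp only [inner_add_left, inner_smul_left, conj_trivial] at h6
  linear_combination h1 + h2 + h4 + κ * h3 + h5 - h6

theorem lowerParab_convexify_sub {S : Set E} {u v : E → ℝ} {Λ ε s₀ κ C : ℝ} {x₀ x p q : E}
    (hε : 0 ≤ ε) (hs : s₀ ≤ u x)
    (hu : LowerParab S u (Λ / 2) x p) (hv : LowerParab S (fun z => -v z) (Λ / 2) x q)
    (hC : convexifyDeriv ε s₀ (u x) * (Λ / 2) + Λ / 2 + κ ≤ C) :
    LowerParab S (fun z => convexify ε s₀ (u z) - v z - κ * ‖z - x₀‖ ^ 2) C x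
      (convexifyDeriv ε s₀ (u x) • p + q - (2 * κ) • (x - x₀)) := by
  intro z hz
  set t := convexifyDeriv ε s₀ (u x) with ht
  have ht0 : 0 ≤ t := zero_le_one.trans (one_le_convexifyDeriv hε hs)
  have h2 := mul_le_mul_of_nonneg_left (hu z hz) ht0
  have h1 := hv z hz
  have h3 := norm_sub_sq_sub_norm_sub_sq x₀ x z
  rw [inner_sub_left] at h3
  have h4 := mul_sub_le_convexify_sub (s₀ := s₀) (s := u x) (s' := u z) hε
  rw [← ht] at h4
  have h5 : (t * (Λ / 2) + Λ / 2 + κ) * ‖z - x‖ ^ 2 ≤ C * ‖z - x‖ ^ 2 := by gcongr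
  simp only [inner_add_left, inner_sub_left, inner_smul_left, conj_trivial] at h1 h2 ⊢
  linear_combination h1 + h2 + h4 + κ * h3 + h5

/-- The contact inequality is divided by `s²` along the ray `x + s e`. The quadratic part of
`convexify` contributes `ε⟪p, e⟫²`, the gain that later makes the inequality strict. -/
theorem contact_hessian_le {S : Set E} {u v : E → ℝ} {ε s₀ κ : ℝ} {x₀ x P p q : E}
    {B D : E →L[ℝ] E} (hx : S ∈ 𝓝 x)
    (hu : HasSecondOrderExpansion u p B x)
    (hv : HasSecondOrderExpansion (fun z => -v z) q D x)
    (hW : UpperParab S (fun z => convexify ε s₀ (u z) - v z - κ * ‖z - x₀‖ ^ 2) 0 x P)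
    (hsum : convexifyDeriv ε s₀ (u x) • p + q = P + (2 * κ) • (x - x₀)) (e : E) :
    convexifyDeriv ε s₀ (u x) * ⟪B e, e⟫ + ε * ⟪p, e⟫ ^ 2 + ⟪D e, e⟫ ≤ 2 * κ * ‖e‖ ^ 2 := by
  set t := convexifyDeriv ε s₀ (u x) with ht
  have l1 := hu.tendsto_ray e
  have l2 := hv.tendsto_ray e
  have l0 : Tendsto (fun s : ℝ => s) (𝓝[>] 0) (𝓝 0) := tendsto_id.mono_left nhdsWithin_le_nhds
  have l3 : Tendsto (fun s : ℝ => ⟪p, e⟫ + s * ((u (x + s • e) - u x - s * ⟪p, e⟫) / s ^ 2))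
      (𝓝[>] 0) (𝓝 (⟪p, e⟫ + 0 * (1 / 2 * ⟪B e, e⟫))) := (l0.mul l1).const_add _
  have hc : Tendsto (fun s : ℝ => x + s • e) (𝓝[>] 0) (𝓝 x) := by
    have : Continuous fun s : ℝ => x + s • e := by fun_prop
    simpa using (this.tendsto 0).mono_left (nhdsWithin_le_nhds (s := Ioi 0))
  have l4 := ((l1.const_mul t).add ((l3.pow 2).const_mul (ε / 2))).add l2
  have := le_of_tendsto l4 (b := κ * ‖e‖ ^ 2) (by
    filter_upwards [hc.eventually hx, self_mem_nhdsWithin] with s hs hs0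
    have hs0 : 0 < s := hs0
    have h1 := hW _ hs
    have h2 := convexify_sub ε s₀ (u x) (u (x + s • e))
    rw [← ht] at h2
    have h3 := norm_sub_sq_sub_norm_sub_sq x₀ x (x + s • e)
    have h6 := congrArg (fun y => ⟪y, e⟫) hsum
    simp only [inner_add_left, inner_smul_left, conj_trivial] at h6
    simp only [add_sub_cancel_left, inner_smul_right, norm_smul, Real.norm_of_nonneg hs0.le,
      mul_pow] at h1 h3
    have h7 : t * (u (x + s • e) - u x) + ε / 2 * (u (x + s • e) - u x) ^ 2
        + (-v (x + s • e) - -v x) ≤ s * (t * ⟪p, e⟫ + ⟪q, e⟫) + κ * (s ^ 2 * ‖e‖ ^ 2) := by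
      linear_combination h1 - h2 + κ * h3 - s * h6
    have e1 : t * ((u (x + s • e) - u x - s * ⟪p, e⟫) / s ^ 2)
        + ε / 2 * (⟪p, e⟫ + s * ((u (x + s • e) - u x - s * ⟪p, e⟫) / s ^ 2)) ^ 2
        + (-v (x + s • e) - -v x - s * ⟪q, e⟫) / s ^ 2
        = (t * (u (x + s • e) - u x) + ε / 2 * (u (x + s • e) - u x) ^ 2
          + (-v (x + s • e) - -v x) - s * (t * ⟪p, e⟫ + ⟪q, e⟫)) / s ^ 2 := by
      field_simp; ring
    rw [e1, div_le_iff₀ (by positivity)]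
    linarith)
  simp only [zero_mul, add_zero] at this
  linarith

/-- At a maximum point of `convexify (u) - v`, with `u` semiconvex and `v` semiconcave, both
functions are touched from both sides by paraboloids, with parallel gradients. -/
theorem exists_contact_gradient [CompleteSpace E] {S : Set E} {u v : E → ℝ} {Λ ε s₀ : ℝ} {x₀ : E}
    (hε : 0 ≤ ε) (hΛ : 0 ≤ Λ) (hu : ContinuousOn u S) (hv : ContinuousOn v S)
    (huc : ConvexOn ℝ S fun z => u z + 1 / 2 * Λ * ‖z‖ ^ 2)
    (hvc : ConvexOn ℝ S fun z => -v z + 1 / 2 * Λ * ‖z‖ ^ 2)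
    (hx : S ∈ 𝓝 x₀) (hs : s₀ ≤ u x₀)
    (hmax : ∀ z ∈ S, convexify ε s₀ (u z) - v z ≤ convexify ε s₀ (u x₀) - v x₀) :
    ∃ p C, Λ / 2 ≤ C ∧ UpperParab S u C x₀ p ∧ LowerParab S u C x₀ p ∧
      UpperParab S (fun z => -v z) C x₀ (-(convexifyDeriv ε s₀ (u x₀) • p)) ∧
      LowerParab S (fun z => -v z) C x₀ (-(convexifyDeriv ε s₀ (u x₀) • p)) := by
  have hxi : x₀ ∈ interior S := mem_interior_iff_mem_nhds.2 hx
  obtain ⟨p, hp⟩ := exists_subgradient huc (hu.add (by fun_prop)) hxi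
  obtain ⟨q, hq⟩ := exists_subgradient hvc (hv.neg.add (by fun_prop)) hxi
  rw [← lowerParab_sub_norm_sq_iff] at hp hq
  have ht1 := one_le_convexifyDeriv hε hs
  have hΛC : Λ / 2 ≤ convexifyDeriv ε s₀ (u x₀) * (Λ / 2) := by nlinarith
  obtain ⟨h1, h2, h3⟩ := contact_parab (x₀ := x₀) (P := 0) hε hΛ le_rfl hx hs hp hq
    (fun z hz => by simpa using hmax z hz) (add_zero _).le
  simp only [mul_zero, zero_smul, add_zero] at h3
  have h4 : q - Λ • x₀ = -(convexifyDeriv ε s₀ (u x₀) • (p - Λ • x₀)) :=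
    (neg_eq_of_add_eq_zero_right h3).symm
  exact ⟨_, _, hΛC, h1, hp.mono hΛC, h4 ▸ h2, h4 ▸ hq.mono hΛC⟩

/-- Near a maximum point of `convexify (u) - v`, with `u` semiconvex and `v` semiconcave, there are
points at which `u` and `v` have second-order expansions with almost ordered Hessians. -/
theorem exists_approx_jets [FiniteDimensional ℝ E] {u v : E → ℝ} {Λ ε s₀ R κ : ℝ} {x₀ : E}
    (hε : 0 ≤ ε) (hΛ : 0 ≤ Λ) (hu : ContinuousOn u (closedBall x₀ R))
    (hv : ContinuousOn v (closedBall x₀ R))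
    (huc : ConvexOn ℝ (closedBall x₀ R) fun z => u z + 1 / 2 * Λ * ‖z‖ ^ 2)
    (hvc : ConvexOn ℝ (closedBall x₀ R) fun z => -v z + 1 / 2 * Λ * ‖z‖ ^ 2)
    (hs : ∀ z ∈ closedBall x₀ R, s₀ ≤ u z)
    (hmax : ∀ z ∈ closedBall x₀ R,
      convexify ε s₀ (u z) - v z ≤ convexify ε s₀ (u x₀) - v x₀)
    (hκ : 0 < κ) (hκR : κ ≤ R / 4) :
    ∃ (x p q : E) (B D : E →L[ℝ] E), ‖x - x₀‖ ≤ κ ∧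
      LowerParab (closedBall x₀ R) u (Λ / 2) x p ∧
      LowerParab (closedBall x₀ R) (fun z => -v z) (Λ / 2) x (-q) ∧
      (∀ a b, ⟪B a, b⟫ = ⟪B b, a⟫) ∧ (∀ a b, ⟪D a, b⟫ = ⟪D b, a⟫) ∧
      HasSecondOrderExpansion u p B x ∧ HasSecondOrderExpansion v q D x ∧
      (∀ e, -Λ * ‖e‖ ^ 2 ≤ ⟪B e, e⟫) ∧ (∀ e, ⟪D e, e⟫ ≤ Λ * ‖e‖ ^ 2) ∧
      ∀ e, convexifyDeriv ε s₀ (u x) * ⟪B e, e⟫ + ε * ⟪p, e⟫ ^ 2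
        ≤ ⟪D e, e⟫ + 2 * κ * ‖e‖ ^ 2 := by
  borelize E
  set S := closedBall x₀ R with hS
  have hScomp : IsCompact S := isCompact_closedBall _ _
  have hR : 0 < R := by linarith
  have hball : ∀ x ∈ ball x₀ R, S ∈ 𝓝 x := fun x hx =>
    mem_of_superset (isOpen_ball.mem_nhds hx) ball_subset_closedBall
  have hfc : ContinuousOn (fun z => u z + 1 / 2 * Λ * ‖z‖ ^ 2) S := hu.add (by fun_prop)
  have hgc : ContinuousOn (fun z => -v z + 1 / 2 * Λ * ‖z‖ ^ 2) S := hv.neg.add (by fun_prop)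
  obtain ⟨N₁, hN₁, hA₁⟩ := exists_null_forall_hasSecondOrderExpansion huc hScomp hfc
  obtain ⟨N₂, hN₂, hA₂⟩ := exists_null_forall_hasSecondOrderExpansion hvc hScomp hgc
  have hsubu : ∀ x ∈ ball x₀ R, ∃ p, LowerParab S (fun z => u z + 1 / 2 * Λ * ‖z‖ ^ 2) 0 x p :=
    fun x hx => exists_subgradient huc hfc (mem_interior_iff_mem_nhds.2 (hball x hx))
  have hsubv : ∀ x ∈ ball x₀ R, ∃ p, LowerParab S (fun z => -v z + 1 / 2 * Λ * ‖z‖ ^ 2) 0 x p :=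
    fun x hx => exists_subgradient hvc hgc (mem_interior_iff_mem_nhds.2 (hball x hx))
  have htc : ContinuousOn (fun z => convexifyDeriv ε s₀ (u z)) S := by
    unfold convexifyDeriv; fun_prop
  obtain ⟨T, hT⟩ := hScomp.bddAbove_image htc
  have hT : ∀ x ∈ S, convexifyDeriv ε s₀ (u x) ≤ T := fun x hx => hT (mem_image_of_mem _ hx)
  have hT0 : 0 ≤ T := zero_le_one.trans ((one_le_convexifyDeriv hε
    (hs x₀ (mem_closedBall_self hR.le))).trans (hT x₀ (mem_closedBall_self hR.le)))
  -- The parameter `κ` is both the size of the penalty that makes the maximum strict and the allowed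
  -- distance from `x₀`. The opening `C` uses the bound `T` on the slope of `convexify`, uniformly
  -- over the ball.
  obtain ⟨x, P, hxκ, hxN, hW⟩ := exists_affine_contact_notMem (x₀ := x₀) (R := R) (κ := κ)
    (C := T * (Λ / 2) + Λ / 2 + κ) (ρ := κ)
    (w := fun z => convexify ε s₀ (u z) - v z - κ * ‖z - x₀‖ ^ 2) (N := N₁ ∪ N₂)
    hκ (by positivity) hκ hκR (by unfold convexify; fun_prop)
    (fun x hx => by
      obtain ⟨p, hp⟩ := hsubu x hx
      obtain ⟨q, hq⟩ := hsubv x hx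
      rw [← lowerParab_sub_norm_sq_iff] at hp hq
      have hxS : x ∈ S := ball_subset_closedBall hx
      exact ⟨_, lowerParab_convexify_sub hε (hs x hxS) hp hq (by gcongr; exact hT x hxS)⟩)
    (fun z hz => by simpa using hmax z hz)
    (measure_union_null hN₁ hN₂)
  have hxb : x ∈ ball x₀ R := by rw [mem_ball, dist_eq_norm]; linarith
  have hxS : x ∈ S := ball_subset_closedBall hxb
  have hxn := hball x hxb
  have hxi := mem_interior_iff_mem_nhds.2 hxn
  obtain ⟨p, hp⟩ := hsubu x hxb
  obtain ⟨q, hq⟩ := hsubv x hxb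
  have hp' := lowerParab_sub_norm_sq_iff.2 hp
  have hq' := lowerParab_sub_norm_sq_iff.2 hq
  have ht0 : 0 ≤ convexifyDeriv ε s₀ (u x) :=
    zero_le_one.trans (one_le_convexifyDeriv hε (hs x hxS))
  obtain ⟨h1, h2, h3⟩ := contact_parab hε hΛ hκ.le hxn (hs x hxS) hp' hq' hW le_rfl
  obtain ⟨B, hBs, hB⟩ := hA₁ x hxi (fun h => hxN (Or.inl h)) p _ (by positivity) hp h1.add_norm_sq
  obtain ⟨D, hDs, hD⟩ := hA₂ x hxi (fun h => hxN (Or.inr h)) q _ (by positivity) hq h2.add_norm_sq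
  have hB0 := hB.inner_nonneg hxn hp
  have hD0 := hD.inner_nonneg hxn hq
  have hle := contact_hessian_le hxn hB.sub_norm_sq hD.sub_norm_sq hW h3
  refine ⟨x, p - Λ • x, -(q - Λ • x), B - Λ • ContinuousLinearMap.id ℝ E,
    -(D - Λ • ContinuousLinearMap.id ℝ E), hxκ, hp', by simpa only [neg_neg] using hq', ?_, ?_,
    hB.sub_norm_sq, hD.sub_norm_sq.neg, ?_, ?_, ?_⟩
  · intro a b
    simp only [_root_.sub_apply, _root_.smul_apply, ContinuousLinearMap.id_apply, inner_sub_left,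
      inner_smul_left, hBs a b, real_inner_comm a b]
  · intro a b
    simp only [_root_.neg_apply, _root_.sub_apply, _root_.smul_apply, ContinuousLinearMap.id_apply,
      inner_neg_left, inner_sub_left, inner_smul_left, hDs a b, real_inner_comm a b]
  · intro e
    simp only [_root_.sub_apply, _root_.smul_apply, ContinuousLinearMap.id_apply, inner_sub_left,
      inner_smul_left, real_inner_self_eq_norm_sq, conj_trivial]
    linarith [hB0 e]
  · intro e
    simp only [_root_.neg_apply, _root_.sub_apply, _root_.smul_apply, ContinuousLinearMap.id_apply,
      inner_neg_left, inner_sub_left, inner_smul_left, real_inner_self_eq_norm_sq, conj_trivial]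
    linarith [hD0 e]
  · intro e
    have := hle e
    rw [_root_.neg_apply, inner_neg_left]
    linarith

end Jets

/-! ### Polynomial test functions with prescribed jets -/

section TestFunctions

variable {E : Type*} [NormedAddCommGroup E] [InnerProductSpace ℝ E]

/-- The polynomial with gradient `p` and Hessian `B` at `x`, and quartic term `c|z - x|⁴`. -/
noncomputable def testPoly (x p : E) (B : E →L[ℝ] E) (c : ℝ) (z : E) : ℝ :=
  ⟪p, z - x⟫ + 1 / 2 * ⟪B (z - x), z - x⟫ + c * (‖z - x‖ ^ 2) ^ 2

theorem contDiff_testPoly (x p : E) (B : E →L[ℝ] E) (c : ℝ) : ContDiff ℝ 2 (testPoly x p B c) := by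
  unfold testPoly
  have h : ContDiff ℝ 2 fun z : E => z - x := by fun_prop
  exact ((contDiff_const.inner ℝ h).add (contDiff_const.mul ((B.contDiff.comp h).inner ℝ h))).add
    (contDiff_const.mul ((h.norm_sq ℝ).pow 2))

theorem testPoly_neg (x p : E) (B : E →L[ℝ] E) (c : ℝ) (z : E) :
    testPoly x (-p) (-B) (-c) z = -testPoly x p B c z := by
  simp only [testPoly, inner_neg_left, _root_.neg_apply]; ring

theorem testPoly_self (x p : E) (B : E →L[ℝ] E) (c : ℝ) : testPoly x p B c x = 0 := by
  simp [testPoly]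

theorem hasFDerivAt_testPoly (x p : E) {B : E →L[ℝ] E} (hB : ∀ a b, ⟪B a, b⟫ = ⟪B b, a⟫) (c : ℝ)
    (z : E) : HasFDerivAt (testPoly x p B c)
      (innerSL ℝ (p + B (z - x) + (4 * c * ‖z - x‖ ^ 2) • (z - x))) z := by
  have h0 : HasFDerivAt (fun z : E => z - x) (ContinuousLinearMap.id ℝ E) z :=
    (hasFDerivAt_id z).sub_const x
  have h1 := (hasFDerivAt_const p z).inner ℝ h0
  have h2 := (B.hasFDerivAt.comp z h0).inner ℝ h0
  have h3 := (h0.norm_sq).pow 2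
  have h := (h1.add (h2.const_mul (1 / 2))).add (h3.const_mul c)
  refine h.congr_fderiv ?_
  ext k
  simp [fderivInnerCLM_apply]
  rw [hB k, map_sub, inner_sub_left]
  ring

theorem hasFDerivAt_gradient_testPoly (x p : E) (B : E →L[ℝ] E) (c : ℝ) :
    HasFDerivAt (fun z => p + B (z - x) + (4 * c * ‖z - x‖ ^ 2) • (z - x)) B x := by
  have h0 : HasFDerivAt (fun z : E => z - x) (ContinuousLinearMap.id ℝ E) x :=
    (hasFDerivAt_id x).sub_const x
  have h := ((B.hasFDerivAt.comp x h0).const_add p).add (((h0.norm_sq).const_mul (4 * c)).smul h0)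
  refine h.congr_fderiv ?_
  ext k
  simp

end TestFunctions

/-! ### Viscosity inequalities at points of second-order expansion -/

section Operator

variable {n m : ℕ} {X : Fin m → EuclideanSpace ℝ (Fin n) → EuclideanSpace ℝ (Fin n)}

/-- The sub-elliptic gradient at `x` of functions with gradient `p` at `x`. -/
noncomputable def subGradJet (X : Fin m → EuclideanSpace ℝ (Fin n) → EuclideanSpace ℝ (Fin n))
    (x p : EuclideanSpace ℝ (Fin n)) : Fin m → ℝ := fun j => ⟪p, X j x⟫

/-- The sub-elliptic second derivative at `x` of functions with gradient `p` and Hessian `B`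
at `x`. -/
noncomputable def subHessJet (X : Fin m → EuclideanSpace ℝ (Fin n) → EuclideanSpace ℝ (Fin n))
    (x p : EuclideanSpace ℝ (Fin n))
    (B : EuclideanSpace ℝ (Fin n) →L[ℝ] EuclideanSpace ℝ (Fin n)) : Matrix (Fin m) (Fin m) ℝ :=
  Matrix.of fun i j => ⟪B (X i x), X j x⟫
    + (⟪p, fderiv ℝ (X j) x (X i x)⟫ + ⟪p, fderiv ℝ (X i) x (X j x)⟫) / 2

theorem subGrad_eq_of_hasFDerivAt {f : EuclideanSpace ℝ (Fin n) → ℝ}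
    {x p : EuclideanSpace ℝ (Fin n)} (h : HasFDerivAt f (innerSL ℝ p) x) :
    subGrad X f x = subGradJet X x p := by
  ext j
  simp [subGrad, lieD, subGradJet, h.fderiv]

theorem subGrad_testPoly (x p : EuclideanSpace ℝ (Fin n))
    {B : EuclideanSpace ℝ (Fin n) →L[ℝ] EuclideanSpace ℝ (Fin n)}
    (hB : ∀ a b, ⟪B a, b⟫ = ⟪B b, a⟫) (c : ℝ) :
    subGrad X (testPoly x p B c) x = subGradJet X x p :=
  subGrad_eq_of_hasFDerivAt (by simpa using hasFDerivAt_testPoly x p hB c x)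

theorem subHess_testPoly {x : EuclideanSpace ℝ (Fin n)} (hX : ∀ j, DifferentiableAt ℝ (X j) x)
    (p : EuclideanSpace ℝ (Fin n))
    {B : EuclideanSpace ℝ (Fin n) →L[ℝ] EuclideanSpace ℝ (Fin n)}
    (hB : ∀ a b, ⟪B a, b⟫ = ⟪B b, a⟫) (c : ℝ) :
    subHess X (testPoly x p B c) x = subHessJet X x p B := by
  have h1 : ∀ j, lieD (X j) (testPoly x p B c)
      = fun z => ⟪p + B (z - x) + (4 * c * ‖z - x‖ ^ 2) • (z - x), X j z⟫ := by
    intro j; ext z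
    simp only [lieD, (hasFDerivAt_testPoly x p hB c z).fderiv, innerSL_apply_apply]
  have h2 : ∀ i j, lieD (X i) (lieD (X j) (testPoly x p B c)) x
      = ⟪B (X i x), X j x⟫ + ⟪p, fderiv ℝ (X j) x (X i x)⟫ := by
    intro i j
    rw [h1 j, lieD, ((hasFDerivAt_gradient_testPoly x p B c).inner ℝ (hX j).hasFDerivAt).fderiv]
    simp [fderivInnerCLM_apply, add_comm]
  ext i j
  simp only [subHess, subHessJet, Matrix.of_apply, h2, hB (X j x) (X i x)]
  ring

theorem gradient_testPoly (x p : EuclideanSpace ℝ (Fin n))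
    {B : EuclideanSpace ℝ (Fin n) →L[ℝ] EuclideanSpace ℝ (Fin n)}
    (hB : ∀ a b, ⟪B a, b⟫ = ⟪B b, a⟫) (c : ℝ) : gradient (testPoly x p B c) x = p := by
  refine HasGradientAt.gradient ?_
  rw [hasGradientAt_iff_hasFDerivAt]
  have := hasFDerivAt_testPoly x p hB c x
  simp only [sub_self, map_zero, add_zero, smul_zero] at this
  exact this

/-- A second-order expansion yields a polynomial touching from above on all of `Ω`. -/
theorem exists_mem_argmaxOn_sub_testPoly {Ω : Set (EuclideanSpace ℝ (Fin n))}
    (hbdd : Bornology.IsBounded Ω) {w : EuclideanSpace ℝ (Fin n) → ℝ} (hw : BddAbove (w '' Ω))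
    {x p : EuclideanSpace ℝ (Fin n)}
    {B : EuclideanSpace ℝ (Fin n) →L[ℝ] EuclideanSpace ℝ (Fin n)} (hx : x ∈ Ω)
    (h : HasSecondOrderExpansion w p B x) {η : ℝ} (hη : 0 < η) :
    ∃ c, x ∈ argmaxOn Ω
      (fun z => w z - testPoly x p (B + (2 * η) • ContinuousLinearMap.id ℝ _) c z) := by
  obtain ⟨r, hr, hb⟩ := Metric.eventually_nhds_iff_ball.1 (h η hη)
  set B' := B + (2 * η) • ContinuousLinearMap.id ℝ (EuclideanSpace ℝ (Fin n)) with hB'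
  obtain ⟨M₁, hM₁⟩ := hw
  obtain ⟨M₂, hM₂⟩ := hbdd.isCompact_closure.bddAbove_image
    (f := fun z => -testPoly x p B' 0 z) (contDiff_testPoly x p B' 0).continuous.neg.continuousOn
  -- The expansion controls `w` only within `r` of `x`. Outside, the quartic term is at least `M`,
  -- which absorbs the bounds on `w` and on the quadratic polynomial over the bounded set `Ω`.
  set M := max (M₁ + M₂ - w x) 0 with hM
  refine ⟨M / r ^ 4, hx, fun z hz => ?_⟩
  simp only [testPoly_self, sub_zero]
  have hsplit : testPoly x p B' (M / r ^ 4) z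
      = testPoly x p B' 0 z + M / r ^ 4 * (‖z - x‖ ^ 2) ^ 2 := by simp [testPoly]
  have hM0 : 0 ≤ M := le_max_right _ _
  rw [hsplit]
  by_cases hzr : z ∈ ball x r
  · have h1 := (abs_le.1 (hb z hzr)).2
    have h2 : 0 ≤ M / r ^ 4 * (‖z - x‖ ^ 2) ^ 2 := by positivity
    have h3 : testPoly x p B' 0 z = ⟪p, z - x⟫ + 1 / 2 * ⟪B (z - x), z - x⟫ + η * ‖z - x‖ ^ 2 := by
      simp only [testPoly, hB', _root_.add_apply, _root_.smul_apply, ContinuousLinearMap.id_apply,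
        inner_add_left, inner_smul_left, real_inner_self_eq_norm_sq, conj_trivial]
      ring
    linarith
  · have h1 := hM₁ (mem_image_of_mem w hz)
    have h2 := hM₂ (mem_image_of_mem _ (subset_closure hz))
    have h3 : r ≤ ‖z - x‖ := by simpa [dist_eq_norm] using hzr
    have h4 : M ≤ M / r ^ 4 * (‖z - x‖ ^ 2) ^ 2 := by
      calc M = M / r ^ 4 * (r ^ 2) ^ 2 := by field_simp
        _ ≤ _ := by gcongr
    have h5 : M₁ + M₂ - w x ≤ M := le_max_left _ _
    linarith

theorem tendsto_clm_apply {F G : Type*} [NormedAddCommGroup F] [NormedSpace ℝ F]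
    [NormedAddCommGroup G] [NormedSpace ℝ G] {ι : Type*} {l : Filter ι} {Ls : ι → F →L[ℝ] G}
    {ys : ι → F} {L : F →L[ℝ] G} {y : F} (hL : Tendsto Ls l (𝓝 L)) (hy : Tendsto ys l (𝓝 y)) :
    Tendsto (fun k => Ls k (ys k)) l (𝓝 (L y)) :=
  (isBoundedBilinearMap_apply.continuous.tendsto (L, y)).comp (hL.prodMk_nhds hy)

theorem tendsto_subGradJet {ι : Type*} {l : Filter ι} {xs ps : ι → EuclideanSpace ℝ (Fin n)}
    {x p : EuclideanSpace ℝ (Fin n)} (hX : ∀ j, ContinuousAt (X j) x)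
    (hxs : Tendsto xs l (𝓝 x)) (hps : Tendsto ps l (𝓝 p)) :
    Tendsto (fun k => subGradJet X (xs k) (ps k)) l (𝓝 (subGradJet X x p)) :=
  tendsto_pi_nhds.2 fun j => hps.inner ((hX j).tendsto.comp hxs)

theorem tendsto_subHessJet {ι : Type*} {l : Filter ι} {xs ps : ι → EuclideanSpace ℝ (Fin n)}
    {Bs : ι → EuclideanSpace ℝ (Fin n) →L[ℝ] EuclideanSpace ℝ (Fin n)}
    {x p : EuclideanSpace ℝ (Fin n)}
    {B : EuclideanSpace ℝ (Fin n) →L[ℝ] EuclideanSpace ℝ (Fin n)}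
    (hX : ∀ j, ContinuousAt (X j) x) (hX' : ∀ j, ContinuousAt (fderiv ℝ (X j)) x)
    (hxs : Tendsto xs l (𝓝 x)) (hps : Tendsto ps l (𝓝 p)) (hBs : Tendsto Bs l (𝓝 B)) :
    Tendsto (fun k => subHessJet X (xs k) (ps k) (Bs k)) l (𝓝 (subHessJet X x p B)) := by
  have h1 : ∀ j, Tendsto (fun k => X j (xs k)) l (𝓝 (X j x)) := fun j => (hX j).tendsto.comp hxs
  have h2 : ∀ j, Tendsto (fun k => fderiv ℝ (X j) (xs k)) l (𝓝 (fderiv ℝ (X j) x)) :=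
    fun j => (hX' j).tendsto.comp hxs
  have h3 : ∀ i j, Tendsto (fun k => fderiv ℝ (X j) (xs k) (X i (xs k))) l
      (𝓝 (fderiv ℝ (X j) x (X i x))) := fun i j => tendsto_clm_apply (h2 j) (h1 i)
  refine tendsto_pi_nhds.2 fun i => tendsto_pi_nhds.2 fun j => ?_
  exact ((tendsto_clm_apply hBs (h1 i)).inner (h1 j)).add
    (((hps.inner (h3 i j)).add (hps.inner (h3 j i))).div_const 2)

theorem tendsto_opL {A : (Fin m → ℝ) → Matrix (Fin m) (Fin m) ℝ} {H : (Fin m → ℝ) → ℝ}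
    (hAc : Continuous A) (hHc : Continuous H) {ι : Type*} {l : Filter ι} {ξs : ι → Fin m → ℝ}
    {Ms : ι → Matrix (Fin m) (Fin m) ℝ} {ξ : Fin m → ℝ} {M : Matrix (Fin m) (Fin m) ℝ}
    (hξ : Tendsto ξs l (𝓝 ξ)) (hM : Tendsto Ms l (𝓝 M)) :
    Tendsto (fun k => -(A (ξs k) * Ms k).trace + H (ξs k)) l (𝓝 (-(A ξ * M).trace + H ξ)) := by
  have hc : Continuous fun y : (Fin m → ℝ) × Matrix (Fin m) (Fin m) ℝ =>
      -(A y.1 * y.2).trace + H y.1 :=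
    ((hAc.comp continuous_fst).matrix_mul continuous_snd).matrix_trace.neg.add
      (hHc.comp continuous_fst)
  have h := (hc.tendsto (ξ, M)).comp (hξ.prodMk_nhds hM)
  exact h

theorem tendsto_add_smul_id
    (B : EuclideanSpace ℝ (Fin n) →L[ℝ] EuclideanSpace ℝ (Fin n)) (a : ℝ) :
    Tendsto (fun η : ℝ => B + (a * η) • ContinuousLinearMap.id ℝ _) (𝓝[>] 0) (𝓝 B) := by
  have hc : Continuous fun η : ℝ =>
    B + (a * η) • ContinuousLinearMap.id ℝ (EuclideanSpace ℝ (Fin n)) := by fun_prop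
  have h := (hc.tendsto 0).mono_left (nhdsWithin_le_nhds (s := Ioi 0))
  have e : B + (a * 0) • ContinuousLinearMap.id ℝ (EuclideanSpace ℝ (Fin n)) = B := by
    ext1 y; simp
  rwa [e] at h

theorem inner_add_smul_id_comm {B : EuclideanSpace ℝ (Fin n) →L[ℝ] EuclideanSpace ℝ (Fin n)}
    (hB : ∀ a b, ⟪B a, b⟫ = ⟪B b, a⟫) (c : ℝ) (a b : EuclideanSpace ℝ (Fin n)) :
    ⟪(B + c • ContinuousLinearMap.id ℝ (EuclideanSpace ℝ (Fin n))) a, b⟫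
      = ⟪(B + c • ContinuousLinearMap.id ℝ (EuclideanSpace ℝ (Fin n))) b, a⟫ := by
  simp only [_root_.add_apply, _root_.smul_apply, ContinuousLinearMap.id_apply, inner_add_left,
    inner_smul_left, hB a b, real_inner_comm a b]

/-- Adding `2η` to the Hessian makes the polynomial touch from above, and a quartic term makes the
touching global. The viscosity inequality then passes to the limit `η → 0` by continuity of the
coefficients. The condition `p ≠ 0` makes the test function admissible. -/
theorem IsViscositySubsolution.opL_jet_nonpos {Ω : Set (EuclideanSpace ℝ (Fin n))}
    (hΩ : IsOpen Ω) (hbdd : Bornology.IsBounded Ω) (hX : ∀ j, ContDiffOn ℝ ∞ (X j) Ω)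
    {A : (Fin m → ℝ) → Matrix (Fin m) (Fin m) ℝ} {H : (Fin m → ℝ) → ℝ}
    (hAc : Continuous A) (hHc : Continuous H) {u : EuclideanSpace ℝ (Fin n) → ℝ}
    (hu : IsViscositySubsolution (opL A H) X Ω u) (hub : BddAbove (u '' Ω))
    {x p : EuclideanSpace ℝ (Fin n)}
    {B : EuclideanSpace ℝ (Fin n) →L[ℝ] EuclideanSpace ℝ (Fin n)} (hx : x ∈ Ω) (hp : p ≠ 0)
    (hB : ∀ a b, ⟪B a, b⟫ = ⟪B b, a⟫) (h : HasSecondOrderExpansion u p B x) :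
    -(A (subGradJet X x p) * subHessJet X x p B).trace + H (subGradJet X x p) ≤ 0 := by
  have hXc : ∀ j, ContDiffAt ℝ ∞ (X j) x := fun j => (hX j).contDiffAt (hΩ.mem_nhds hx)
  refine le_of_tendsto (tendsto_opL hAc hHc tendsto_const_nhds
    (tendsto_subHessJet (fun j => (hXc j).continuousAt)
      (fun j => ((hXc j).fderiv_right (m := 0) (by simp)).continuousAt) tendsto_const_nhds
      tendsto_const_nhds (tendsto_add_smul_id B 2))) ?_
  filter_upwards [self_mem_nhdsWithin] with η hη
  obtain ⟨c, hc⟩ := exists_mem_argmaxOn_sub_testPoly hbdd hub hx h hη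
  have hs := inner_add_smul_id_comm hB (2 * η)
  have := hu.2 x hx _ ⟨(contDiff_testPoly x p _ c).contDiffOn, hc,
    by rwa [gradient_testPoly x p hs c]⟩
  rwa [subGrad_testPoly x p hs, subHess_testPoly (fun j => (hXc j).differentiableAt (by simp)) p hs,
    opL] at this

theorem IsViscositySupersolution.opL_jet_nonneg {Ω : Set (EuclideanSpace ℝ (Fin n))}
    (hΩ : IsOpen Ω) (hbdd : Bornology.IsBounded Ω) (hX : ∀ j, ContDiffOn ℝ ∞ (X j) Ω)
    {A : (Fin m → ℝ) → Matrix (Fin m) (Fin m) ℝ} {H : (Fin m → ℝ) → ℝ}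
    (hAc : Continuous A) (hHc : Continuous H) {v : EuclideanSpace ℝ (Fin n) → ℝ}
    (hv : IsViscositySupersolution (opL A H) X Ω v) (hvb : BddAbove ((fun z => -v z) '' Ω))
    {x p : EuclideanSpace ℝ (Fin n)}
    {B : EuclideanSpace ℝ (Fin n) →L[ℝ] EuclideanSpace ℝ (Fin n)} (hx : x ∈ Ω) (hp : p ≠ 0)
    (hB : ∀ a b, ⟪B a, b⟫ = ⟪B b, a⟫) (h : HasSecondOrderExpansion v p B x) :
    0 ≤ -(A (subGradJet X x p) * subHessJet X x p B).trace + H (subGradJet X x p) := by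
  have hXc : ∀ j, ContDiffAt ℝ ∞ (X j) x := fun j => (hX j).contDiffAt (hΩ.mem_nhds hx)
  refine ge_of_tendsto (tendsto_opL hAc hHc tendsto_const_nhds
    (tendsto_subHessJet (fun j => (hXc j).continuousAt)
      (fun j => ((hXc j).fderiv_right (m := 0) (by simp)).continuousAt) tendsto_const_nhds
      tendsto_const_nhds (tendsto_add_smul_id B (-2)))) ?_
  filter_upwards [self_mem_nhdsWithin] with η hη
  have h' : HasSecondOrderExpansion (fun z => -v z) (-p) (-B) x :=
    HasSecondOrderExpansion.neg (by simpa only [neg_neg] using h)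
  obtain ⟨c, hc⟩ := exists_mem_argmaxOn_sub_testPoly hbdd hvb hx h' hη
  have hs := inner_add_smul_id_comm hB (-2 * η)
  have e : -B + (2 * η) • ContinuousLinearMap.id ℝ (EuclideanSpace ℝ (Fin n))
      = -(B + (-2 * η) • ContinuousLinearMap.id ℝ _) := by module
  have hmin : x ∈ argminOn Ω (fun z => v z
      - testPoly x p (B + (-2 * η) • ContinuousLinearMap.id ℝ _) (-c) z) := by
    refine ⟨hx, fun z hz => ?_⟩
    have := hc.2 z hz
    have e2 := testPoly_neg x p (B + (-2 * η) • ContinuousLinearMap.id ℝ _) (-c)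
    rw [neg_neg] at e2
    simp only [e, e2] at this
    linarith
  have := hv.2 x hx _ ⟨(contDiff_testPoly x p _ (-c)).contDiffOn, hmin,
    by rwa [gradient_testPoly x p hs (-c)]⟩
  rwa [subGrad_testPoly x p hs, subHess_testPoly (fun j => (hXc j).differentiableAt (by simp)) p hs,
    opL] at this

end Operator

/-! ### Strictness from scaling, and passage to the limit -/

section Comparison

theorem trace_mul_nonneg_of_posSemidef {m : ℕ} {A P : Matrix (Fin m) (Fin m) ℝ}
    (hA : A.PosSemidef) (hP : P.PosSemidef) : 0 ≤ (A * P).trace := by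
  obtain ⟨k, w, rfl⟩ := Matrix.posSemidef_iff_eq_sum_vecMulVec.1 hA
  rw [Matrix.sum_mul, Matrix.trace_sum]
  refine Finset.sum_nonneg fun i _ => ?_
  rw [Matrix.trace_mul_comm, Matrix.mul_vecMulVec, Matrix.trace_vecMulVec, dotProduct_comm]
  exact hP.dotProduct_mulVec_nonneg (w i)

/-- The change of the dependent variable makes subsolutions strict. -/
theorem not_ordered_jets {m : ℕ} {A : (Fin m → ℝ) → Matrix (Fin m) (Fin m) ℝ}
    {H : (Fin m → ℝ) → ℝ} (hA : ∀ ξ, (A ξ).PosSemidef)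
    (hell : ∀ ξ, ξ ≠ 0 → 0 < (A ξ *ᵥ ξ) ⬝ᵥ ξ)
    {φ : ℝ → ℝ} (hφ : ∀ s, 0 < s → s ≤ 1 → 0 < φ s)
    (hscaleA : ∀ t : ℝ, 1 ≤ t → ∀ ξ, ξ ≠ 0 → ∀ M : Matrix (Fin m) (Fin m) ℝ, M.IsSymm →
      -(A (t • ξ) * M).trace ≤ -(A ξ * M).trace / (t * φ (1 / t)))
    (hscaleH : ∀ t : ℝ, 1 ≤ t → ∀ ξ, ξ ≠ 0 → H (t • ξ) ≤ 1 / φ (1 / t) * H ξ)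
    {ε t : ℝ} (hε : 0 < ε) (ht : 1 ≤ t) {ξ : Fin m → ℝ} (hξ : ξ ≠ 0)
    {M M' : Matrix (Fin m) (Fin m) ℝ} (hM : M.IsSymm)
    (hMM : (M' - (t • M + ε • Matrix.vecMulVec ξ ξ)).PosSemidef)
    (hsub : -(A ξ * M).trace + H ξ ≤ 0) (hsup : 0 ≤ -(A (t • ξ) * M').trace + H (t • ξ)) :
    False := by
  have ht0 : 0 < t := by linarith
  have hφ0 : 0 < φ (1 / t) := hφ _ (by positivity) (by rw [div_le_one ht0]; exact ht)
  have h1 := trace_mul_nonneg_of_posSemidef (hA (t • ξ)) hMM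
  rw [Matrix.mul_sub, Matrix.trace_sub] at h1
  have hsymm : (t • M + ε • Matrix.vecMulVec ξ ξ).IsSymm := by
    refine (hM.smul t).add (Matrix.IsSymm.smul ?_ ε)
    ext i j; simp [Matrix.vecMulVec_apply, mul_comm]
  -- Scaling is applied to the transformed second derivative, so its factor `t` cancels against `t
  -- φ(1/t)`, leaving the same multiplier `1/φ(1/t)` as for `H`.
  have h2 := hscaleA t ht ξ hξ _ hsymm
  have h3 := hscaleH t ht ξ hξ
  have h4 : (A ξ * (t • M + ε • Matrix.vecMulVec ξ ξ)).trace
      = t * (A ξ * M).trace + ε * ((A ξ *ᵥ ξ) ⬝ᵥ ξ) := by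
    rw [Matrix.mul_add, Matrix.trace_add, Matrix.mul_smul, Matrix.mul_smul, Matrix.trace_smul,
      Matrix.trace_smul, Matrix.mul_vecMulVec, Matrix.trace_vecMulVec]
    simp
  have h5 := mul_pos hε (hell ξ hξ)
  rw [h4] at h2
  have h6 : -(t * (A ξ * M).trace + ε * ((A ξ *ᵥ ξ) ⬝ᵥ ξ)) / (t * φ (1 / t))
      + 1 / φ (1 / t) * H ξ
      = 1 / φ (1 / t) * (-(A ξ * M).trace + H ξ)
        - ε * ((A ξ *ᵥ ξ) ⬝ᵥ ξ) / (t * φ (1 / t)) := by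
    field_simp; ring
  have h7 : 1 / φ (1 / t) * (-(A ξ * M).trace + H ξ) ≤ 0 :=
    mul_nonpos_of_nonneg_of_nonpos (by positivity) hsub
  have h8 : 0 < ε * ((A ξ *ᵥ ξ) ⬝ᵥ ξ) / (t * φ (1 / t)) := by positivity
  linarith

/-- Polarisation: `4⟪Ba, b⟫` is the difference of the quadratic form at `a + b` and `a - b`, tested
with `b` along `Ba` and no longer than `a`. -/
theorem opNorm_le_of_abs_inner_le {E : Type*} [NormedAddCommGroup E] [InnerProductSpace ℝ E]
    {B : E →L[ℝ] E} (hB : ∀ a b, ⟪B a, b⟫ = ⟪B b, a⟫) {c : ℝ} (hc : 0 ≤ c)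
    (h : ∀ e, |⟪B e, e⟫| ≤ c * ‖e‖ ^ 2) : ‖B‖ ≤ c := by
  refine B.opNorm_le_bound hc fun a => ?_
  rcases (norm_nonneg a).eq_or_lt with h0 | h0
  · have : a = 0 := norm_eq_zero.1 h0.symm
    simp [this]
  obtain ⟨b, hb, hab⟩ := exists_mem_closedBall_inner_eq 0 (B a) (norm_nonneg a)
  rw [sub_zero] at hb hab
  have h1 := (abs_le.1 (h (a + b))).2
  have h2 := (abs_le.1 (h (a - b))).1
  have h3 := parallelogram_law_with_norm ℝ a b
  simp only [map_add, map_sub, inner_add_left, inner_add_right, inner_sub_left, inner_sub_right,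
    hB b a] at h1 h2
  have h5 : ‖b‖ ^ 2 ≤ ‖a‖ ^ 2 := by gcongr
  have h6 : c * ‖b‖ ^ 2 ≤ c * ‖a‖ ^ 2 := by gcongr
  have h4 : c * ‖a + b‖ ^ 2 + c * ‖a - b‖ ^ 2 = 2 * (c * ‖a‖ ^ 2 + c * ‖b‖ ^ 2) := by
    linear_combination c * h3
  refine le_of_mul_le_mul_left (?_ : ‖a‖ * ‖B a‖ ≤ ‖a‖ * (c * ‖a‖)) h0
  linarith

variable {n m : ℕ} {X : Fin m → EuclideanSpace ℝ (Fin n) → EuclideanSpace ℝ (Fin n)}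

theorem subGradJet_smul (x p : EuclideanSpace ℝ (Fin n)) (t : ℝ) :
    subGradJet X x (t • p) = t • subGradJet X x p := by
  ext j; simp [subGradJet, inner_smul_left]

theorem subHessJet_isSymm (x p : EuclideanSpace ℝ (Fin n))
    {B : EuclideanSpace ℝ (Fin n) →L[ℝ] EuclideanSpace ℝ (Fin n)}
    (hB : ∀ a b, ⟪B a, b⟫ = ⟪B b, a⟫) : (subHessJet X x p B).IsSymm := by
  ext i j
  simp only [Matrix.transpose_apply, subHessJet, Matrix.of_apply, hB (X j x) (X i x)]
  ring

/-- The terms of `subHessJet` that involve derivatives of the fields are linear in the gradient.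
With gradients exactly `p` and `t • p` they cancel, leaving the Euclidean ordering tested on
combinations of the `X i x`. -/
theorem posSemidef_subHessJet_sub {x p : EuclideanSpace ℝ (Fin n)} {t ε : ℝ}
    {B D : EuclideanSpace ℝ (Fin n) →L[ℝ] EuclideanSpace ℝ (Fin n)}
    (hB : ∀ a b, ⟪B a, b⟫ = ⟪B b, a⟫) (hD : ∀ a b, ⟪D a, b⟫ = ⟪D b, a⟫)
    (h : ∀ e, t * ⟪B e, e⟫ + ε * ⟪p, e⟫ ^ 2 ≤ ⟪D e, e⟫) :
    (subHessJet X x (t • p) D - (t • subHessJet X x p B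
      + ε • Matrix.vecMulVec (subGradJet X x p) (subGradJet X x p))).PosSemidef := by
  have hent : ∀ i j, (subHessJet X x (t • p) D - (t • subHessJet X x p B
      + ε • Matrix.vecMulVec (subGradJet X x p) (subGradJet X x p))) i j
      = ⟪D (X i x), X j x⟫ - t * ⟪B (X i x), X j x⟫ - ε * (⟪p, X i x⟫ * ⟪p, X j x⟫) := by
    intro i j
    simp only [subHessJet, subGradJet, Matrix.sub_apply, Matrix.add_apply, Matrix.smul_apply,
      Matrix.of_apply, Matrix.vecMulVec_apply, inner_smul_left, smul_eq_mul, conj_trivial]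
    ring
  refine Matrix.PosSemidef.of_dotProduct_mulVec_nonneg ?_ fun y => ?_
  · ext i j
    rw [Matrix.conjTranspose_apply, star_trivial, hent, hent, hB (X j x), hD (X j x)]
    ring
  · have h1 := h (∑ i, y i • X i x)
    have hq : ∀ L : EuclideanSpace ℝ (Fin n) →L[ℝ] EuclideanSpace ℝ (Fin n),
        ⟪L (∑ i, y i • X i x), ∑ i, y i • X i x⟫
          = ∑ i, ∑ j, y i * (⟪L (X i x), X j x⟫ * y j) := by
      intro L
      simp only [map_sum, map_smul, sum_inner, inner_sum, inner_smul_left, inner_smul_right,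
        conj_trivial, Finset.mul_sum]
      rw [Finset.sum_comm]
      refine Finset.sum_congr rfl fun i _ => Finset.sum_congr rfl fun j _ => ?_
      ring
    have hl : ⟪p, ∑ i, y i • X i x⟫ ^ 2 = ∑ i, ∑ j, y i * (⟪p, X i x⟫ * ⟪p, X j x⟫ * y j) := by
      simp only [inner_sum, inner_smul_right, sq, Finset.sum_mul_sum]
      refine Finset.sum_congr rfl fun i _ => Finset.sum_congr rfl fun j _ => ?_
      ring
    rw [hq, hq, hl] at h1
    have h2 : star y ⬝ᵥ ((subHessJet X x (t • p) D - (t • subHessJet X x p B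
        + ε • Matrix.vecMulVec (subGradJet X x p) (subGradJet X x p))) *ᵥ y)
        = (∑ i, ∑ j, y i * (⟪D (X i x), X j x⟫ * y j))
          - t * (∑ i, ∑ j, y i * (⟪B (X i x), X j x⟫ * y j))
          - ε * (∑ i, ∑ j, y i * (⟪p, X i x⟫ * ⟪p, X j x⟫ * y j)) := by
      simp only [dotProduct, Matrix.mulVec, hent, star_trivial, Finset.mul_sum,
        ← Finset.sum_sub_distrib]
      refine Finset.sum_congr rfl fun i _ => Finset.sum_congr rfl fun j _ => ?_
      ring
    rw [h2]
    linarith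

/-- A maximum point of `convexify (u) - v` at which the sub-elliptic gradient does not vanish is
impossible. -/
theorem not_contact_of_subGradJet_ne_zero {Ω : Set (EuclideanSpace ℝ (Fin n))}
    (hΩ : IsOpen Ω) (hbdd : Bornology.IsBounded Ω) (hX : ∀ j, ContDiffOn ℝ ∞ (X j) Ω)
    {A : (Fin m → ℝ) → Matrix (Fin m) (Fin m) ℝ} {H : (Fin m → ℝ) → ℝ}
    (hAc : Continuous A) (hHc : Continuous H) (hA : ∀ ξ, (A ξ).PosSemidef)
    (hell : ∀ ξ, ξ ≠ 0 → 0 < (A ξ *ᵥ ξ) ⬝ᵥ ξ)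
    {φ : ℝ → ℝ} (hφ : ∀ s, 0 < s → s ≤ 1 → 0 < φ s)
    (hscaleA : ∀ t : ℝ, 1 ≤ t → ∀ ξ, ξ ≠ 0 → ∀ M : Matrix (Fin m) (Fin m) ℝ, M.IsSymm →
      -(A (t • ξ) * M).trace ≤ -(A ξ * M).trace / (t * φ (1 / t)))
    (hscaleH : ∀ t : ℝ, 1 ≤ t → ∀ ξ, ξ ≠ 0 → H (t • ξ) ≤ 1 / φ (1 / t) * H ξ)
    {u v : EuclideanSpace ℝ (Fin n) → ℝ}
    (husub : IsViscositySubsolution (opL A H) X Ω u)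
    (hvsup : IsViscositySupersolution (opL A H) X Ω v)
    (hub : BddAbove (u '' Ω)) (hvb : BddAbove ((fun z => -v z) '' Ω))
    {x₀ p₀ : EuclideanSpace ℝ (Fin n)} {Λ ε s₀ R C : ℝ} (hR : 0 < R)
    (hball : closedBall x₀ R ⊆ Ω)
    (hε : 0 < ε) (hΛ : 0 ≤ Λ) (hu : ContinuousOn u (closedBall x₀ R))
    (hv : ContinuousOn v (closedBall x₀ R))
    (huc : ConvexOn ℝ (closedBall x₀ R) fun z => u z + 1 / 2 * Λ * ‖z‖ ^ 2)
    (hvc : ConvexOn ℝ (closedBall x₀ R) fun z => -v z + 1 / 2 * Λ * ‖z‖ ^ 2)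
    (hs : ∀ z ∈ closedBall x₀ R, s₀ ≤ u z)
    (hmax : ∀ z ∈ closedBall x₀ R,
      convexify ε s₀ (u z) - v z ≤ convexify ε s₀ (u x₀) - v x₀)
    (hp₀ : LowerParab (closedBall x₀ R) u C x₀ p₀) (hξ : subGradJet X x₀ p₀ ≠ 0) : False := by
  have hx₀S : x₀ ∈ closedBall x₀ R := mem_closedBall_self hR.le
  have hSn : closedBall x₀ R ∈ 𝓝 x₀ := closedBall_mem_nhds x₀ hR
  obtain ⟨p', C', hC', hup, hlo, hvup, hvlo⟩ := exists_contact_gradient hε.le hΛ hu hv huc hvc hSn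
    (hs x₀ hx₀S) hmax
  -- At the maximum `u` is touched from both sides, so any lower touching slope is the gradient.
  obtain rfl := eq_of_parab hSn hp₀ hup
  have hC'0 : 0 ≤ C' := by linarith
  set t₀ := convexifyDeriv ε s₀ (u x₀) with ht₀
  have ht₀1 : 1 ≤ t₀ := one_le_convexifyDeriv hε.le (hs x₀ hx₀S)
  set δ : ℝ := min 1 (R / 4) with hδ
  have hδ0 : 0 < δ := by positivity
  have hκpos : ∀ k : ℕ, 0 < δ * (1 / ((k : ℝ) + 1)) := fun k => by positivity
  have hκle : ∀ k : ℕ, δ * (1 / ((k : ℝ) + 1)) ≤ δ := fun k =>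
    mul_le_of_le_one_right hδ0.le (by
      rw [div_le_one (by positivity)]
      linarith [k.cast_nonneg (α := ℝ)])
  have hκlim : Tendsto (fun k : ℕ => δ * (1 / ((k : ℝ) + 1))) atTop (𝓝 0) := by
    simpa using (tendsto_one_div_add_atTop_nhds_zero_nat (𝕜 := ℝ)).const_mul δ
  choose x p q B D hxκ hpl hql hBs hDs hBe hDe hBlo hDup hle using fun k : ℕ =>
    exists_approx_jets hε.le hΛ hu hv huc hvc hs hmax (hκpos k)
      ((hκle k).trans (min_le_right _ _))
  have hxR : ∀ k, ‖x k - x₀‖ ≤ R / 4 := fun k =>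
    (hxκ k).trans ((hκle k).trans (min_le_right _ _))
  have hxS : ∀ k, x k ∈ closedBall x₀ R := fun k => by
    rw [mem_closedBall, dist_eq_norm]; linarith [hxR k]
  have hnorm : Tendsto (fun k => ‖x k - x₀‖) atTop (𝓝 0) :=
    squeeze_zero (fun _ => norm_nonneg _) hxκ hκlim
  have hxlim : Tendsto x atTop (𝓝 x₀) := tendsto_iff_norm_sub_tendsto_zero.2 hnorm
  have hsmall : ∀ k, closedBall (x k) (R / 2) ⊆ closedBall x₀ R := fun k =>
    closedBall_subset_closedBall' (by rw [dist_eq_norm]; linarith [hxR k])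
  have hlim0 : Tendsto (fun k => 6 * C' * ‖x k - x₀‖) atTop (𝓝 0) := by
    simpa using hnorm.const_mul (6 * C')
  have hplim : Tendsto p atTop (𝓝 p₀) := by
    refine tendsto_iff_norm_sub_tendsto_zero.2 (squeeze_zero (fun _ => norm_nonneg _) (fun k => ?_)
      hlim0)
    exact norm_sub_le_mul_norm_sub_of_parab hC'0 hup hlo ((hpl k).mono hC')
      (by linarith [hxR k]) (hsmall k)
  have hqlim : Tendsto q atTop (𝓝 (t₀ • p₀)) := by
    refine tendsto_iff_norm_sub_tendsto_zero.2 (squeeze_zero (fun _ => norm_nonneg _) (fun k => ?_)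
      hlim0)
    have := norm_sub_le_mul_norm_sub_of_parab hC'0 hvup hvlo ((hql k).mono hC')
      (by linarith [hxR k] : ‖x k - x₀‖ < R / 2) (hsmall k)
    rwa [← neg_sub_neg, norm_sub_rev]
  have hulim : Tendsto (fun k => u (x k)) atTop (𝓝 (u x₀)) :=
    (hu.continuousAt hSn).tendsto.comp hxlim
  have htlim : Tendsto (fun k => convexifyDeriv ε s₀ (u (x k))) atTop (𝓝 t₀) :=
    ((hulim.sub_const s₀).const_mul ε).const_add 1
  obtain ⟨T, hT⟩ := htlim.bddAbove_range
  have hT : ∀ k, convexifyDeriv ε s₀ (u (x k)) ≤ T := fun k => hT (mem_range_self k)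
  have ht1 : ∀ k, 1 ≤ convexifyDeriv ε s₀ (u (x k)) := fun k =>
    one_le_convexifyDeriv hε.le (hs _ (hxS k))
  have hT1 : 1 ≤ T := (ht1 0).trans (hT 0)
  have hκ1 : ∀ k : ℕ, δ * (1 / ((k : ℝ) + 1)) ≤ 1 := fun k => (hκle k).trans (min_le_left _ _)
  have hΛT : Λ ≤ T * Λ := le_mul_of_one_le_left hΛ hT1
  -- Semiconvexity bounds `B` below and semiconcavity bounds `D` above. The ordering transfers each
  -- bound to the other operator, so a subsequence of the Hessians converges.
  have hlow : ∀ k e, -(T * Λ) * ‖e‖ ^ 2 ≤ convexifyDeriv ε s₀ (u (x k)) * ⟪B k e, e⟫ := by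
    intro k e
    have h1 := mul_le_mul_of_nonneg_left (hBlo k e) (zero_le_one.trans (ht1 k))
    have h2 : convexifyDeriv ε s₀ (u (x k)) * (Λ * ‖e‖ ^ 2) ≤ T * (Λ * ‖e‖ ^ 2) := by
      gcongr; exact hT k
    linarith
  have hDlow : ∀ k e, -(T * Λ + 2) * ‖e‖ ^ 2 ≤ ⟪D k e, e⟫ := by
    intro k e
    have h1 := hle k e
    have h2 := hlow k e
    have h3 : (δ * (1 / ((k : ℝ) + 1))) * ‖e‖ ^ 2 ≤ 1 * ‖e‖ ^ 2 := by gcongr; exact hκ1 k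
    have h4 : 0 ≤ ε * ⟪p k, e⟫ ^ 2 := by positivity
    linarith
  have hBup : ∀ k e, ⟪B k e, e⟫ ≤ (T * Λ + 2) * ‖e‖ ^ 2 := by
    intro k e
    have h1 := hle k e
    have h2 := hDup k e
    have h3 : (δ * (1 / ((k : ℝ) + 1))) * ‖e‖ ^ 2 ≤ 1 * ‖e‖ ^ 2 := by gcongr; exact hκ1 k
    have h4 : 0 ≤ ε * ⟪p k, e⟫ ^ 2 := by positivity
    have h5 : Λ * ‖e‖ ^ 2 ≤ T * Λ * ‖e‖ ^ 2 := by gcongr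
    rcases le_total 0 ⟪B k e, e⟫ with h0 | h0
    · have h6 : ⟪B k e, e⟫ ≤ convexifyDeriv ε s₀ (u (x k)) * ⟪B k e, e⟫ :=
        le_mul_of_one_le_left h0 (ht1 k)
      linarith
    · exact h0.trans (by positivity)
  have hBn : ∀ k, ‖B k‖ ≤ T * Λ + 2 := fun k =>
    opNorm_le_of_abs_inner_le (hBs k) (by positivity) fun e => abs_le.2
      ⟨by nlinarith [hBlo k e, sq_nonneg ‖e‖], hBup k e⟩
  have hDn : ∀ k, ‖D k‖ ≤ T * Λ + 2 := fun k =>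
    opNorm_le_of_abs_inner_le (hDs k) (by positivity) fun e => abs_le.2
      ⟨by linarith [hDlow k e], by nlinarith [hDup k e, sq_nonneg ‖e‖]⟩
  have : ProperSpace (EuclideanSpace ℝ (Fin n) →L[ℝ] EuclideanSpace ℝ (Fin n)) :=
    FiniteDimensional.proper ℝ _
  obtain ⟨⟨B₀, D₀⟩, -, ψ, hψ, hlim⟩ := ((isCompact_closedBall
      (0 : EuclideanSpace ℝ (Fin n) →L[ℝ] EuclideanSpace ℝ (Fin n)) (T * Λ + 2)).prod
      (isCompact_closedBall
      (0 : EuclideanSpace ℝ (Fin n) →L[ℝ] EuclideanSpace ℝ (Fin n)) (T * Λ + 2))).tendsto_subseq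
      (x := fun k => (B k, D k)) fun k => ⟨by simpa using hBn k, by simpa using hDn k⟩
  have hBlim : Tendsto (fun k => B (ψ k)) atTop (𝓝 B₀) := (Prod.tendsto_iff _ _).1 hlim |>.1
  have hDlim : Tendsto (fun k => D (ψ k)) atTop (𝓝 D₀) := (Prod.tendsto_iff _ _).1 hlim |>.2
  have hψt := hψ.tendsto_atTop
  have hBab : ∀ a b, Tendsto (fun k => ⟪B (ψ k) a, b⟫) atTop (𝓝 ⟪B₀ a, b⟫) := fun a b =>
    (tendsto_clm_apply hBlim tendsto_const_nhds).inner tendsto_const_nhds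
  have hDab : ∀ a b, Tendsto (fun k => ⟪D (ψ k) a, b⟫) atTop (𝓝 ⟪D₀ a, b⟫) := fun a b =>
    (tendsto_clm_apply hDlim tendsto_const_nhds).inner tendsto_const_nhds
  have hB₀s : ∀ a b, ⟪B₀ a, b⟫ = ⟪B₀ b, a⟫ := fun a b =>
    tendsto_nhds_unique (hBab a b) ((hBab b a).congr fun k => hBs _ b a)
  have hD₀s : ∀ a b, ⟪D₀ a, b⟫ = ⟪D₀ b, a⟫ := fun a b =>
    tendsto_nhds_unique (hDab a b) ((hDab b a).congr fun k => hDs _ b a)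
  -- The error `2κ` vanishes in the limit, while the gain `ε⟪p₀, e⟫²` stays because `ε` is fixed.
  have hle₀ : ∀ e, t₀ * ⟪B₀ e, e⟫ + ε * ⟪p₀, e⟫ ^ 2 ≤ ⟪D₀ e, e⟫ := by
    intro e
    have l1 := ((htlim.comp hψt).mul (hBab e e)).add
      ((((hplim.comp hψt).inner (tendsto_const_nhds (x := e))).pow 2).const_mul ε)
    have l2 := (hDab e e).add (((hκlim.comp hψt).const_mul 2).mul_const (‖e‖ ^ 2))
    have := le_of_tendsto_of_tendsto' l1 l2 fun k => hle (ψ k) e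
    simpa using this
  have hx₀Ω : x₀ ∈ Ω := hball hx₀S
  have hXc : ∀ j, ContDiffAt ℝ ∞ (X j) x₀ := fun j => (hX j).contDiffAt (hΩ.mem_nhds hx₀Ω)
  have hX0 : ∀ j, ContinuousAt (X j) x₀ := fun j => (hXc j).continuousAt
  have hX1 : ∀ j, ContinuousAt (fderiv ℝ (X j)) x₀ := fun j =>
    ((hXc j).fderiv_right (m := 0) (by simp)).continuousAt
  have hp0 : p₀ ≠ 0 := by
    rintro rfl
    exact hξ (by ext j; simp [subGradJet])
  have hq0 : t₀ • p₀ ≠ 0 := smul_ne_zero (by linarith) hp0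
  have hsub : -(A (subGradJet X x₀ p₀) * subHessJet X x₀ p₀ B₀).trace + H (subGradJet X x₀ p₀)
      ≤ 0 := by
    refine le_of_tendsto (tendsto_opL hAc hHc
      (tendsto_subGradJet hX0 (hxlim.comp hψt) (hplim.comp hψt))
      (tendsto_subHessJet hX0 hX1 (hxlim.comp hψt) (hplim.comp hψt) hBlim)) ?_
    filter_upwards [(hplim.comp hψt).eventually_ne hp0] with k hk
    exact husub.opL_jet_nonpos hΩ hbdd hX hAc hHc hub (hball (hxS _)) hk (hBs _) (hBe _)
  have hsup : 0 ≤ -(A (subGradJet X x₀ (t₀ • p₀)) * subHessJet X x₀ (t₀ • p₀) D₀).trace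
      + H (subGradJet X x₀ (t₀ • p₀)) := by
    refine ge_of_tendsto (tendsto_opL hAc hHc
      (tendsto_subGradJet hX0 (hxlim.comp hψt) (hqlim.comp hψt))
      (tendsto_subHessJet hX0 hX1 (hxlim.comp hψt) (hqlim.comp hψt) hDlim)) ?_
    filter_upwards [(hqlim.comp hψt).eventually_ne hq0] with k hk
    exact hvsup.opL_jet_nonneg hΩ hbdd hX hAc hHc hvb (hball (hxS _)) hk (hDs _) (hDe _)
  rw [subGradJet_smul] at hsup
  exact not_ordered_jets hA hell hφ hscaleA hscaleH hε ht₀1 hξ (subHessJet_isSymm x₀ p₀ hB₀s)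
    (posSemidef_subHessJet_sub hB₀s hD₀s hle₀) hsub hsup

theorem convexOn_add_norm_sq_mono {E : Type*} [NormedAddCommGroup E] [InnerProductSpace ℝ E]
    {S : Set E} {f : E → ℝ} {Λ Λ' : ℝ} (h : ConvexOn ℝ S fun z => f z + 1 / 2 * Λ * ‖z‖ ^ 2)
    (hΛ : Λ ≤ Λ') : ConvexOn ℝ S fun z => f z + 1 / 2 * Λ' * ‖z‖ ^ 2 := by
  have h1 : ConvexOn ℝ S fun z : E => ‖z‖ ^ 2 :=
    (convexOn_norm h.1).pow (fun _ _ => norm_nonneg _) 2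
  have h2 := h.add (h1.smul (by linarith : 0 ≤ 1 / 2 * (Λ' - Λ)))
  refine h2.congr fun z _ => ?_
  simp only [Pi.add_apply, smul_eq_mul]
  ring

/-- Maximum points of `convexify (u) - v` accumulate, as `ε → 0`, at maximum points of `u - v`. -/
theorem exists_tendsto_argmax {E : Type*} [MetricSpace E] {K : Set E} (hK : IsCompact K)
    (hne : K.Nonempty) {u v : E → ℝ} (hu : ContinuousOn u K) (hv : ContinuousOn v K) (s₀ : ℝ) :
    ∃ (ε : ℕ → ℝ) (y : ℕ → E), (∀ k, 0 < ε k) ∧ (∀ k, y k ∈ K) ∧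
      (∀ k, ∀ z ∈ K, convexify (ε k) s₀ (u z) - v z ≤ convexify (ε k) s₀ (u (y k)) - v (y k)) ∧
      ∃ y₀ ∈ K, Tendsto y atTop (𝓝 y₀) ∧ ∀ z ∈ K, u z - v z ≤ u y₀ - v y₀ := by
  have hex : ∀ k : ℕ, ∃ y ∈ K, ∀ z ∈ K, convexify (1 / ((k : ℝ) + 1)) s₀ (u z) - v z
      ≤ convexify (1 / ((k : ℝ) + 1)) s₀ (u y) - v y := fun k => by
    obtain ⟨y, hy, h⟩ := hK.exists_isMaxOn hne
      (f := fun z => convexify (1 / ((k : ℝ) + 1)) s₀ (u z) - v z) (by unfold convexify; fun_prop)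
    exact ⟨y, hy, fun z hz => h hz⟩
  choose y hyK hy using hex
  obtain ⟨y₀, hy₀, ψ, hψ, hlim⟩ := hK.tendsto_subseq hyK
  refine ⟨fun k => 1 / ((ψ k : ℝ) + 1), fun k => y (ψ k), fun k => by positivity,
    fun k => hyK _, fun k => hy _, y₀, hy₀, hlim, fun z hz => ?_⟩
  have hw : Tendsto (fun k => y (ψ k)) atTop (𝓝[K] y₀) :=
    tendsto_nhdsWithin_iff.2 ⟨hlim, Eventually.of_forall fun k => hyK _⟩
  have lu : Tendsto (fun k => u (y (ψ k))) atTop (𝓝 (u y₀)) := (hu y₀ hy₀).tendsto.comp hw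
  have lv : Tendsto (fun k => v (y (ψ k))) atTop (𝓝 (v y₀)) := (hv y₀ hy₀).tendsto.comp hw
  have le : Tendsto (fun k => 1 / ((ψ k : ℝ) + 1)) atTop (𝓝 0) :=
    (tendsto_one_div_add_atTop_nhds_zero_nat (𝕜 := ℝ)).comp hψ.tendsto_atTop
  have l := (lu.add ((le.div_const 2).mul ((lu.sub_const s₀).pow 2))).sub lv
  -- The quadratic term is dropped at `z`, where it is nonnegative, and vanishes in the limit at the
  -- maximum points.
  have := ge_of_tendsto' (b := u z - v z) l fun k => by
    have h1 := hy (ψ k) z hz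
    have h2 : 0 ≤ 1 / ((ψ k : ℝ) + 1) / 2 * (u z - s₀) ^ 2 := by positivity
    unfold convexify at h1
    linarith
  simpa using this

end Comparison

end SubElliptic

/-! ### The comparison principle -/

open SubElliptic in
theorem mainTheorem3 {n m : ℕ} (Ω : Set (EuclideanSpace ℝ (Fin n)))
    (hΩ : IsOpen Ω) (hbdd : Bornology.IsBounded Ω)
    -- smooth vector fields on `Ω`
    (X : Fin m → EuclideanSpace ℝ (Fin n) → EuclideanSpace ℝ (Fin n))
    (hX : ∀ j, ContDiffOn ℝ ∞ (X j) Ω)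
    -- coefficients
    (A : (Fin m → ℝ) → Matrix (Fin m) (Fin m) ℝ) (H : (Fin m → ℝ) → ℝ)
    (hAc : Continuous A) (hHc : Continuous H)
    (hA : ∀ ξ, (A ξ).PosSemidef)
    -- strict ellipticity
    (hell : ∀ ξ, ξ ≠ 0 → 0 < (A ξ *ᵥ ξ) ⬝ᵥ ξ)
    -- scaling
    (φ : ℝ → ℝ) (hφ : ∀ s, 0 < s → s ≤ 1 → 0 < φ s)
    (hscaleA : ∀ t : ℝ, 1 ≤ t → ∀ ξ, ξ ≠ 0 → ∀ M : Matrix (Fin m) (Fin m) ℝ, M.IsSymm →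
      -(A (t • ξ) * M).trace ≤ -(A ξ * M).trace / (t * φ (1 / t)))
    (hscaleH : ∀ t : ℝ, 1 ≤ t → ∀ ξ, ξ ≠ 0 → H (t • ξ) ≤ 1 / φ (1 / t) * H ξ)
    (u v : EuclideanSpace ℝ (Fin n) → ℝ)
    (hu : ContinuousOn u (closure Ω)) (hv : ContinuousOn v (closure Ω))
    (husc : SubElliptic.IsSemiconvex Ω u) (hvsc : SubElliptic.IsSemiconcave Ω v)
    (husub : SubElliptic.IsViscositySubsolution (SubElliptic.opL A H) X Ω u)
    (hvsup : SubElliptic.IsViscositySupersolution (SubElliptic.opL A H) X Ω v)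
    (hbd : ∀ x ∈ frontier Ω, u x ≤ v x)
    (hnd : (∀ x ∈ SubElliptic.argmaxOn Ω (fun y => u y - v y), SubElliptic.subGrad X u x ≠ 0) ∨
      (∀ x ∈ SubElliptic.argmaxOn Ω (fun y => u y - v y), SubElliptic.subGrad X v x ≠ 0)) :
    ∀ x ∈ Ω, u x ≤ v x := by
  by_contra! hcon
  obtain ⟨a, haΩ, ha⟩ := hcon
  have hK : IsCompact (closure Ω) := hbdd.isCompact_closure
  have hne : (closure Ω).Nonempty := ⟨a, subset_closure haΩ⟩
  obtain ⟨b, -, hb⟩ := hK.exists_isMinOn hne hu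
  have hs : ∀ z ∈ closure Ω, u b ≤ u z := fun z hz => hb hz
  obtain ⟨ε, y, hε, hyK, hymax, y₀, hy₀K, hylim, hy₀max⟩ :=
    exists_tendsto_argmax hK hne hu hv (u b)
  have hy₀Ω : y₀ ∈ Ω := by
    by_contra hy
    have h1 := hbd y₀ ⟨hy₀K, fun h => hy (interior_subset h)⟩
    have h2 := hy₀max a (subset_closure haΩ)
    linarith
  obtain ⟨Λ₁, hΛ₁, huc⟩ := husc
  obtain ⟨Λ₂, hΛ₂, hvc⟩ := hvsc
  set Λ := max Λ₁ Λ₂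
  have hΛ : 0 ≤ Λ := hΛ₁.le.trans (le_max_left _ _)
  have huc' : ∀ s ⊆ Ω, Convex ℝ s → ConvexOn ℝ s fun z => u z + 1 / 2 * Λ * ‖z‖ ^ 2 :=
    fun s h h' => convexOn_add_norm_sq_mono (huc s h h') (le_max_left _ _)
  have hvc' : ∀ s ⊆ Ω, Convex ℝ s → ConvexOn ℝ s fun z => -v z + 1 / 2 * Λ * ‖z‖ ^ 2 :=
    fun s h h' => convexOn_add_norm_sq_mono (hvc s h h') (le_max_right _ _)
  obtain ⟨R, hR, hball⟩ := Metric.nhds_basis_closedBall.mem_iff.1 (hΩ.mem_nhds hy₀Ω)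
  have hSn : Metric.closedBall y₀ R ∈ nhds y₀ := Metric.closedBall_mem_nhds y₀ hR
  have hconv : ∀ (z : EuclideanSpace ℝ (Fin n)) r, Convex ℝ (Metric.closedBall z r) := fun z r => convex_closedBall z r
  have huS := hu.mono (hball.trans subset_closure)
  have hvS := hv.mono (hball.trans subset_closure)
  -- With `ε = 0` the change of variable is the identity with slope 1, so `u` and `v` have the same
  -- gradient `p₀` at `y₀`.
  obtain ⟨p₀, C, hC, hup, hlo, hvup, hvlo⟩ := exists_contact_gradient (ε := 0) (s₀ := u b) le_rfl
    hΛ huS hvS (huc' _ hball (hconv _ _)) (hvc' _ hball (hconv _ _)) hSn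
    (hs _ hy₀K) (fun z hz => by simpa [convexify] using hy₀max z (subset_closure (hball hz)))
  have hderu := hasFDerivAt_of_parab hSn hup hlo
  have hderv : HasFDerivAt v (innerSL ℝ p₀) y₀ := by
    have := (hasFDerivAt_of_parab hSn hvup hvlo).neg
    have e : (-fun z => -v z) = v := by ext z; simp
    simpa [convexifyDeriv, e] using this
  have harg : y₀ ∈ argmaxOn Ω (fun z => u z - v z) :=
    ⟨hy₀Ω, fun z hz => hy₀max z (subset_closure hz)⟩
  have hξ₀ : subGradJet X y₀ p₀ ≠ 0 := by
    rcases hnd with h | h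
    · rw [← subGrad_eq_of_hasFDerivAt hderu]; exact h y₀ harg
    · rw [← subGrad_eq_of_hasFDerivAt hderv]; exact h y₀ harg
  have hsub : ∀ z ∈ Metric.ball y₀ R, ∃ p, LowerParab (Metric.closedBall y₀ R) u (Λ / 2) z p := by
    intro z hz
    obtain ⟨p, hp⟩ := exists_subgradient (huc' _ hball (hconv _ _)) (huS.add (by fun_prop))
      (Metric.ball_subset_interior_closedBall hz)
    exact ⟨_, lowerParab_sub_norm_sq_iff.2 hp⟩
  choose! p hp using hsub
  have hev : ∀ᶠ k in Filter.atTop, y k ∈ Metric.ball y₀ (R / 2) :=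
    hylim (Metric.ball_mem_nhds y₀ (half_pos hR))
  have hsmall : ∀ z ∈ Metric.ball y₀ (R / 2),
      Metric.closedBall z (R / 2) ⊆ Metric.closedBall y₀ R := fun z hz =>
    Metric.closedBall_subset_closedBall' (by linarith [Metric.mem_ball.1 hz])
  have hnorm := tendsto_iff_norm_sub_tendsto_zero.1 hylim
  -- The Lipschitz estimate for touching gradients, based at the differentiability point `y₀`,
  -- carries `𝔛u ≠ 0` over to `y k` for large `k`.
  have hplim : Filter.Tendsto (fun k => p (y k)) Filter.atTop (nhds p₀) := by
    refine tendsto_iff_norm_sub_tendsto_zero.2 (squeeze_zero' (Filter.Eventually.of_forall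
      fun _ => norm_nonneg _) ?_ (by simpa using hnorm.const_mul (6 * C)))
    filter_upwards [hev] with k hk
    exact norm_sub_le_mul_norm_sub_of_parab (by linarith) hup hlo
      ((hp _ (Metric.ball_subset_ball (by linarith) hk)).mono hC)
      (by simpa [dist_eq_norm] using hk) (hsmall _ hk)
  have hXc : ∀ j, ContinuousAt (X j) y₀ := fun j =>
    (hX j).continuousOn.continuousAt (hΩ.mem_nhds hy₀Ω)
  obtain ⟨k, hk, hξk⟩ := (hev.and
    ((tendsto_subGradJet hXc hylim hplim).eventually_ne hξ₀)).exists
  have hkS := hsmall _ hk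
  have hkΩ := hkS.trans hball
  have hkK := hkΩ.trans subset_closure
  exact not_contact_of_subGradJet_ne_zero hΩ hbdd hX hAc hHc hA hell hφ hscaleA hscaleH husub hvsup
    ((hK.bddAbove_image hu).mono (Set.image_mono subset_closure))
    ((hK.bddAbove_image hv.neg).mono (Set.image_mono subset_closure))
    (half_pos hR) hkΩ (hε k) hΛ (hu.mono hkK) (hv.mono hkK) (huc' _ hkΩ (hconv _ _))
    (hvc' _ hkΩ (hconv _ _)) (fun z hz => hs z (hkK hz)) (fun z hz => hymax k z (hkK hz))
    (fun z hz => hp _ (Metric.ball_subset_ball (by linarith) hk) z (hkS hz)) hξk
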